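/- Let $$ \begin{aligned} Q(a_1,a_2,a_3)={}&(2s_1+4s_3-1)\bigl(64s_1^5-64s_1^4+8s_1^3+12s_1^2-6s_1+1\\ &\qquad+240s_3s_1^2-240s_3s_1-1536s_3^2s_1-4096s_3^3+60s_3+768s_3^2\bigr)\\ &-8s_1(2s_1+4s_3-1)(2s_1-32s_3-1)(10s_1+32s_3-5)s_2\\ &-16s_1^2(13-52s_1+640s_3s_1+1024s_3^2-320s_3+52s_1^2)s_2^2\\ &+64(2s_1-1)(2s_1-32s_3-1)s_2^3+2048s_1(2s_1-1)s_2^4, \end{aligned} $$ where $s_1=a_1+a_2+a_3$, $s_2=a_1a_2+a_1a_3+a_2a_3$, $s_3=a_1a_2a_3$, and let $\Omega=\{(a_1,a_2,a_3)\in\mathbb{R}^3 \mid Q(a_1,a_2,a_3)=0\}$. With respect to the standard topology of $\mathbb{R}^3$: 1. the set $(0,1/2)^3\cap\Omega$ is connected (and non-empty); 2. the set $(0,1/2)^3\setminus\Omega$ has exactly three connected components $O_1$, $O_2$, $O_3$, which contain the points $(1/6,1/6,1/6)$, $(7/15,7/15,7/15)$ and $(1/6,1/4,1/3)$ respectively.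 -/

import Mathlib

/-- The symmetric polynomial `Q` of degree 12, written through the elementary symmetric
polynomials `s₁`, `s₂`, `s₃` of its three arguments. -/
def polyQ (a₁ a₂ a₃ : ℝ) : ℝ :=
  let s₁ := a₁ + a₂ + a₃
  let s₂ := a₁ * a₂ + a₁ * a₃ + a₂ * a₃
  let s₃ := a₁ * a₂ * a₃
  (2 * s₁ + 4 * s₃ - 1) *
      (64 * s₁ ^ 5 - 64 * s₁ ^ 4 + 8 * s₁ ^ 3 + 12 * s₁ ^ 2 - 6 * s₁ + 1
        + 240 * s₃ * s₁ ^ 2 - 240 * s₃ * s₁ - 1536 * s₃ ^ 2 * s₁ - 4096 * s₃ ^ 3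
        + 60 * s₃ + 768 * s₃ ^ 2)
    - 8 * s₁ * (2 * s₁ + 4 * s₃ - 1) * (2 * s₁ - 32 * s₃ - 1) * (10 * s₁ + 32 * s₃ - 5) * s₂
    - 16 * s₁ ^ 2 *
      (13 - 52 * s₁ + 640 * s₃ * s₁ + 1024 * s₃ ^ 2 - 320 * s₃ + 52 * s₁ ^ 2) * s₂ ^ 2
    + 64 * (2 * s₁ - 1) * (2 * s₁ - 32 * s₃ - 1) * s₂ ^ 3
    + 2048 * s₁ * (2 * s₁ - 1) * s₂ ^ 4

/-- The real algebraic surface `Ω = {(a₁, a₂, a₃) ∈ ℝ³ | Q(a₁, a₂, a₃) = 0}`. -/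
def surfaceOmega : Set (Fin 3 → ℝ) :=
  {a | polyQ (a 0) (a 1) (a 2) = 0}

/-- The open cube `(0, 1/2)³`. -/
def openCube : Set (Fin 3 → ℝ) :=
  {a | ∀ i, a i ∈ Set.Ioo (0 : ℝ) (1 / 2)}

/-- The set of all connected components of a subset `S` of a topological space
(each of them a subset of `S`). -/
def componentsOf {X : Type*} [TopologicalSpace X] (S : Set X) : Set (Set X) :=
  {C | ∃ x ∈ S, C = connectedComponentIn S x}

/-! `Q` is minus the discriminant of the cubic `p(z) = pencilCubic a b c z`, and it is symmetric, so
triples may be taken sorted. Then `p` has a root in `(-∞, -1]`, and the sign of `Q` is read off on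
`z > 0`: a negative value of `p` there forces `Q < 0` (`polyQ_neg_of_pencilCubic_neg`), while `p ≥ δ
z (z + 1)` with `δ > 0` forces `Q > 0` (`polyQ_pos_of_pencilCubic_ge`).

Dividing by `z (z + 1)`, these conditions compare `2 s₁ - 1` with `4αβγ`, where `α, β, γ` are linear
in the triple and all equal `2t` at the diagonal point `(t, t, t)`. Two inequalities follow. By
Minkowski for geometric means, `Q ≤ 0` at a point with `s₁ ≠ 3/4` gives `Q < 0` on the rest of the
segment to its diagonal projection (`polyQ_segment_neg`). By AM-GM, `Q > 0` on the slice `s₁ = 3/4`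
except at `(1/4, 1/4, 1/4)`; by a Chebyshev-type inequality, every other point with `Q ≥ 0` is
joined to this slice by a chord on which `Q > 0` past the starting point (`exists_chord`).

So `{Q < 0}` contracts to the diagonal on each side of `s₁ = 3/4`, giving two components, and `{Q >
0}` contracts to a punctured planar slice, giving the third. The zero set is the continuous image of
the connected set `{Q ≥ 0}` under the map sending a point to the unique zero on its segment to the
diagonal. -/

/-! ### `Q` as a discriminant -/

/-- The characteristic cubic of the pencil of conics cut out by the Einstein equations, in the affine
coordinate `z`. -/
def pencilCubic (a b c z : ℝ) : ℝ :=
  (2 * (a + b + c) - 1) * (z * (z + 1)) -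
    4 * ((a * (1 + z) + b * z + c) * (a * (1 + z) - b * z + c) * (a * (1 + z) + b * z - c))

def pencilCoeffThree (a b : ℝ) : ℝ := 4 * (b - a) * (a + b) ^ 2

def pencilCoeffTwo (a b c : ℝ) : ℝ :=
  2 * (a + b + c) - 1 - 4 * (a + b) * ((a + c) * (a + b) - 2 * a * (b - a))

theorem pencilCubic_eq (a b c z : ℝ) :
    pencilCubic a b c z = pencilCoeffThree a b * z ^ 3 + pencilCoeffTwo a b c * z ^ 2 +
      pencilCoeffTwo a c b * z + pencilCoeffThree a c := by
  unfold pencilCubic pencilCoeffThree pencilCoeffTwo; ring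

/-- The discriminant of a binary cubic form. -/
def cubicDisc (A B C D : ℝ) : ℝ :=
  B ^ 2 * C ^ 2 - 4 * A * C ^ 3 - 4 * B ^ 3 * D - 27 * A ^ 2 * D ^ 2 + 18 * A * B * C * D

theorem polyQ_eq_neg_disc (a b c : ℝ) :
    polyQ a b c = -cubicDisc (pencilCoeffThree a b) (pencilCoeffTwo a b c)
      (pencilCoeffTwo a c b) (pencilCoeffThree a c) := by
  simp only [polyQ, cubicDisc, pencilCoeffThree, pencilCoeffTwo]; ring

theorem polyQ_swap₁₂ (a b c : ℝ) : polyQ b a c = polyQ a b c := by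
  have h1 : b + a + c = a + b + c := by ring
  have h2 : b * a + b * c + a * c = a * b + a * c + b * c := by ring
  have h3 : b * a * c = a * b * c := by ring
  simp only [polyQ, h1, h2, h3]

theorem polyQ_swap₂₃ (a b c : ℝ) : polyQ a c b = polyQ a b c := by
  have h1 : a + c + b = a + b + c := by ring
  have h2 : a * c + a * b + c * b = a * b + a * c + b * c := by ring
  have h3 : a * c * b = a * b * c := by ring
  simp only [polyQ, h1, h2, h3]

theorem polyQ_diag (t : ℝ) : polyQ t t t = -((4 * t - 1) ^ 2 * (2 * t + 1)) ^ 4 := by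
  rw [polyQ_eq_neg_disc]; unfold cubicDisc pencilCoeffThree pencilCoeffTwo; ring

/-! ### Sign of the discriminant of a real cubic -/

section Cubic

variable {A B C D : ℝ}

/-- Splitting off the root leaves a quadratic: the discriminant is that of the quadratic times the
square of its value at `r`. -/
theorem cubicDisc_of_root {r : ℝ} (hr : A * r ^ 3 + B * r ^ 2 + C * r + D = 0) :
    cubicDisc A B C D = ((B + A * r) ^ 2 - 4 * A * (C + (B + A * r) * r)) *
      (A * r ^ 2 + (B + A * r) * r + (C + (B + A * r) * r)) ^ 2 := by
  have hD : D = -((C + (B + A * r) * r) * r) := by linear_combination hr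
  subst hD; unfold cubicDisc; ring

theorem exists_cubic_root_le (hA : 0 < A) {x : ℝ} (hx : 0 ≤ A * x ^ 3 + B * x ^ 2 + C * x + D) :
    ∃ r ≤ x, A * r ^ 3 + B * r ^ 2 + C * r + D = 0 := by
  -- A Cauchy-type bound: `N ≥ 1`, `-N ≤ x` and `A * N ≥ |B| + |C| + |D|`, so the cubic term
  -- dominates at `-N`.
  set N : ℝ := 1 + |x| + (|B| + |C| + |D|) / A with hN
  have hM : 0 ≤ (|B| + |C| + |D|) / A := by positivity
  have hAM : A * ((|B| + |C| + |D|) / A) = |B| + |C| + |D| := by field_simp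
  have hN1 : 1 ≤ N := by have := abs_nonneg x; linarith
  have hAN : |B| + |C| + |D| ≤ A * N := by
    rw [hN]
    have := mul_nonneg hA.le (abs_nonneg x)
    nlinarith
  have hNx : -N ≤ x := by have := neg_abs_le x; linarith
  have hneg : A * (-N) ^ 3 + B * (-N) ^ 2 + C * (-N) + D ≤ 0 := by
    have h1 : B * N ^ 2 ≤ |B| * N ^ 2 := by gcongr; exact le_abs_self B
    have h2 : -C * N ≤ |C| * N ^ 2 := by
      have : -C * N ≤ |C| * N := by gcongr; exact neg_le_abs C
      nlinarith [abs_nonneg C, mul_nonneg (abs_nonneg C) (by nlinarith : 0 ≤ N ^ 2 - N)]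
    have h3 : D ≤ |D| * N ^ 2 := by
      nlinarith [le_abs_self D, mul_nonneg (abs_nonneg D) (by nlinarith : 0 ≤ N ^ 2 - 1)]
    have h4 : (|B| + |C| + |D|) * N ^ 2 ≤ A * N * N ^ 2 := by gcongr
    nlinarith
  have hc : ContinuousOn (fun y : ℝ => A * y ^ 3 + B * y ^ 2 + C * y + D) (Set.Icc (-N) x) := by
    fun_prop
  obtain ⟨r, hr, h⟩ := intermediate_value_Icc hNx hc ⟨hneg, hx⟩
  exact ⟨r, hr.2, h⟩

/-- After splitting off a root `r ≤ -1`, the quadratic cofactor opens upwards, is nonnegative at `0`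
and negative at `z > 0`. Hence its discriminant is positive and its linear coefficient negative, so
it does not vanish at `r`. -/
theorem cubicDisc_pos (hA : 0 < A) (hm : 0 ≤ A * (-1) ^ 3 + B * (-1) ^ 2 + C * (-1) + D)
    (h0 : 0 ≤ D) {z : ℝ} (hz : 0 < z) (hpz : A * z ^ 3 + B * z ^ 2 + C * z + D < 0) :
    0 < cubicDisc A B C D := by
  obtain ⟨r, hr1, hr⟩ := exists_cubic_root_le hA hm
  rw [cubicDisc_of_root hr]
  set β := B + A * r with hβ
  set γ := C + β * r with hγ
  have hD : D = -(γ * r) := by rw [hγ, hβ]; linear_combination hr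
  have hq0 : 0 ≤ γ := by
    by_contra! h
    nlinarith
  have hqz : A * z ^ 2 + β * z + γ < 0 := by
    have : A * z ^ 3 + B * z ^ 2 + C * z + D = (z - r) * (A * z ^ 2 + β * z + γ) := by
      rw [hD, hγ, hβ]; ring
    rw [this] at hpz
    by_contra! h
    have := mul_nonneg (by linarith : 0 ≤ z - r) h
    linarith
  have hβneg : β < 0 := by
    by_contra! h
    have := mul_nonneg h hz.le
    have := mul_pos hA (pow_pos hz 2)
    linarith
  have hqr : 0 < A * r ^ 2 + β * r + γ := by
    have := mul_pos hA (pow_pos (by linarith : 0 < -r) 2)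
    have := mul_pos_of_neg_of_neg hβneg (by linarith : r < 0)
    nlinarith
  have hΔ : 0 < β ^ 2 - 4 * A * γ := by
    have h2 : (2 * A * z + β) ^ 2 = β ^ 2 - 4 * A * γ + 4 * A * (A * z ^ 2 + β * z + γ) := by ring
    have := sq_nonneg (2 * A * z + β)
    have := mul_pos hA (neg_pos.2 hqz)
    nlinarith
  positivity

/-- If all three roots were real, they would all be at most `-1`, and the derivative at the middle
one would be nonpositive, against `hder`. So the quadratic cofactor has no real root. -/
theorem cubicDisc_neg (hA : 0 < A) (hm : 0 ≤ A * (-1) ^ 3 + B * (-1) ^ 2 + C * (-1) + D)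
    (hpos : ∀ z > -1, 0 < A * z ^ 3 + B * z ^ 2 + C * z + D)
    (hder : ∀ z ≤ -1, A * z ^ 3 + B * z ^ 2 + C * z + D = 0 →
      0 < 3 * A * z ^ 2 + 2 * B * z + C) :
    cubicDisc A B C D < 0 := by
  obtain ⟨r, -, hr⟩ := exists_cubic_root_le hA hm
  rw [cubicDisc_of_root hr]
  set β := B + A * r with hβ
  set γ := C + β * r with hγ
  have hD : D = -(γ * r) := by rw [hγ, hβ]; linear_combination hr
  have hΔ : β ^ 2 - 4 * A * γ < 0 := by
    by_contra! hΔ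
    set s := Real.sqrt (β ^ 2 - 4 * A * γ) with hs
    have hss : s ^ 2 = β ^ 2 - 4 * A * γ := Real.sq_sqrt hΔ
    have hs0 : 0 ≤ s := Real.sqrt_nonneg _
    obtain ⟨u, hu⟩ : ∃ u, 2 * A * u = -β - s := ⟨(-β - s) / (2 * A), by field_simp⟩
    obtain ⟨v, hv⟩ : ∃ v, 2 * A * v = -β + s := ⟨(-β + s) / (2 * A), by field_simp⟩
    have huv : u ≤ v := by
      by_contra! h
      have := mul_lt_mul_of_pos_left h (by linarith : 0 < 2 * A)
      linarith
    have eβ : β = -A * (u + v) := by linarith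
    have eγ : γ = A * (u * v) := by
      have h4 : 4 * A * (γ - A * (u * v)) = 0 := by
        have : (2 * A * u) * (2 * A * v) = β ^ 2 - s ^ 2 := by rw [hu, hv]; ring
        linarith
      have := (mul_eq_zero.1 h4).resolve_left (by positivity)
      linarith
    have eB : B = -A * (u + v + r) := by linarith
    have eC : C = A * (u * v + (u + v) * r) := by
      have : C = γ - β * r := by rw [hγ]; ring
      rw [this, eγ, eβ]; ring
    have eD : D = -A * (u * v * r) := by rw [hD, eγ]; ring
    have root : ∀ z, A * z ^ 3 + B * z ^ 2 + C * z + D = A * ((z - u) * (z - v) * (z - r)) := by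
      intro z; rw [eB, eC, eD]; ring
    have der : ∀ z, 3 * A * z ^ 2 + 2 * B * z + C =
        A * ((z - u) * (z - v) + (z - u) * (z - r) + (z - v) * (z - r)) := by
      intro z; rw [eB, eC]; ring
    have bound : ∀ z, A * z ^ 3 + B * z ^ 2 + C * z + D = 0 → z ≤ -1 := by
      intro z hz
      by_contra! h
      have := hpos z h
      linarith
    have hcontra : ∀ z w₁ w₂, A * z ^ 3 + B * z ^ 2 + C * z + D = 0 → w₁ ≤ z → z ≤ w₂ →
        3 * A * z ^ 2 + 2 * B * z + C = A * ((z - w₁) * (z - w₂)) → False := by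
      intro z w₁ w₂ hz h1 h2 hd
      have hp := hder z (bound z hz) hz
      have := mul_nonneg hA.le (mul_nonneg (sub_nonneg.2 h1) (sub_nonneg.2 h2))
      nlinarith
    rcases le_total r u with h | h
    · exact hcontra u r v (by rw [root]; ring) h huv (by rw [der]; ring)
    · rcases le_total r v with h' | h'
      · exact hcontra r u v (by rw [root]; ring) h h' (by rw [der]; ring)
      · exact hcontra v u r (by rw [root]; ring) huv h' (by rw [der]; ring)
  have hqr : A * r ^ 2 + β * r + γ ≠ 0 := by
    intro h
    have : (2 * A * r + β) ^ 2 = β ^ 2 - 4 * A * γ := by linear_combination 4 * A * h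
    nlinarith [sq_nonneg (2 * A * r + β)]
  have := pow_pos (abs_pos.2 hqr) 2
  rw [sq_abs] at this
  exact mul_neg_of_neg_of_pos hΔ this

end Cubic

/-! ### Reading the sign of `Q` from the cubic on `z > 0` -/

theorem pencilCubic_neg_one (a b c : ℝ) :
    pencilCubic a b c (-1) = 4 * (c - b) * (b + c) ^ 2 := by
  unfold pencilCubic; ring

/-- When the first two arguments coincide the leading coefficient vanishes and the cubic lemmas no
longer apply; this form replaces them. -/
theorem pencilCubic_of_eq (a c z : ℝ) :
    pencilCubic a a c z = pencilCoeffTwo a a c * (z ^ 2 + z) + pencilCoeffThree a c := by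
  unfold pencilCubic pencilCoeffTwo pencilCoeffThree; ring

theorem polyQ_of_eq (a c : ℝ) :
    polyQ a a c = -(pencilCoeffTwo a a c ^ 3 *
      (pencilCoeffTwo a a c - 4 * pencilCoeffThree a c)) := by
  rw [polyQ_eq_neg_disc]
  unfold cubicDisc pencilCoeffThree pencilCoeffTwo; ring

theorem pencilCoeffThree_nonneg {a b : ℝ} (hab : a ≤ b) : 0 ≤ pencilCoeffThree a b :=
  mul_nonneg (by linarith) (sq_nonneg _)

theorem pencilCoeffThree_pos {a b : ℝ} (ha : 0 < a) (hab : a < b) : 0 < pencilCoeffThree a b :=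
  mul_pos (by linarith) (pow_pos (by linarith) 2)

theorem polyQ_neg_of_pencilCubic_neg {a b c z : ℝ} (ha : 0 < a) (hab : a ≤ b) (hbc : b ≤ c)
    (hz : 0 < z) (h : pencilCubic a b c z < 0) : polyQ a b c < 0 := by
  have hD := pencilCoeffThree_nonneg (hab.trans hbc)
  rcases hab.eq_or_lt with rfl | hab'
  · rw [pencilCubic_of_eq] at h
    rw [polyQ_of_eq]
    have hB : pencilCoeffTwo a a c < 0 := by
      by_contra! hB
      have := mul_nonneg hB (by positivity : 0 ≤ z ^ 2 + z)
      linarith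
    have h3 : pencilCoeffTwo a a c ^ 3 < 0 := Odd.pow_neg (by decide) hB
    have := mul_pos_of_neg_of_neg h3
      (by linarith : pencilCoeffTwo a a c - 4 * pencilCoeffThree a c < 0)
    linarith
  · rw [polyQ_eq_neg_disc, neg_lt_zero]
    refine cubicDisc_pos (pencilCoeffThree_pos ha hab') ?_ hD hz
      (by rw [← pencilCubic_eq]; exact h)
    rw [← pencilCubic_eq, pencilCubic_neg_one]
    exact mul_nonneg (by linarith) (sq_nonneg _)

/-- This is what positivity of the cubic on `(-1, 0)` reduces to. With `U = b + c`, `V = a + c`, the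
difference of the sides is `(c - b) + (4U²V - U - 2V + 1)`; the bracket times `U` is a sum of
nonnegative terms. Strictness comes from `c > b`, or from `b > a` when `b = c`. -/
theorem cubic_bound {a b c : ℝ} (ha : 0 < a) (hab : a ≤ b) (hbc : b ≤ c) (hac : a < c)
    (hc : c < 1 / 2) : 2 * (a + b + c) - 1 < 4 * (b + c) ^ 2 * (a + c) := by
  have hU : 0 < b + c := by linarith
  have hV : 0 < a + c := by linarith
  have h1 : 0 ≤ (a + c) * ((2 * (b + c) - 1) ^ 2 * (b + c + 1)) := by positivity
  have h2 : 0 ≤ (b - a) * (1 - (b + c)) := mul_nonneg (by linarith) (by linarith)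
  have key : (b + c) * (4 * (b + c) ^ 2 * (a + c) - (b + c) - 2 * (a + c) + 1) =
      (b - a) * (1 - (b + c)) + (a + c) * ((2 * (b + c) - 1) ^ 2 * (b + c + 1)) := by ring
  have h3 : 0 ≤ 4 * (b + c) ^ 2 * (a + c) - (b + c) - 2 * (a + c) + 1 := by
    by_contra! h
    have := mul_neg_of_pos_of_neg hU h
    linarith
  rcases hbc.eq_or_lt with rfl | hbc'
  · have h4 : 0 < (b - a) * (1 - (b + b)) := mul_pos (by linarith) (by linarith)
    have h5 : 0 < 4 * (b + b) ^ 2 * (a + b) - (b + b) - 2 * (a + b) + 1 := by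
      by_contra! h
      have := mul_nonpos_of_nonneg_of_nonpos hU.le h
      linarith
    linarith
  · linarith

theorem pencilCubic_pos_of_mem_Ioo {a b c z : ℝ} (ha : 0 < a) (hab : a ≤ b) (hbc : b ≤ c)
    (hac : a < c) (hc : c < 1 / 2) (hz : z ∈ Set.Ioo (-1 : ℝ) 0) : 0 < pencilCubic a b c z := by
  obtain ⟨s, rfl⟩ : ∃ s, z = -s := ⟨-z, by ring⟩
  have hs0 : 0 < s := by linarith [hz.2]
  have hs1 : 0 < 1 - s := by linarith [hz.1]
  have key : pencilCubic a b c (-s) = -(2 * (a + b + c) - 1) * (s * (1 - s)) +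
      4 * (((c + a * (1 - s) + b * s) * (c - a * (1 - s) + b * s)) *
        (c + a * (1 - s) - b * s)) := by
    unfold pencilCubic; ring
  have h1 : (1 - s) * (a + c) ≤ c + a * (1 - s) - b * s := by
    nlinarith [mul_nonneg (sub_nonneg.2 hbc) hs0.le]
  have h2 : s * (b + c) ^ 2 ≤ (c + a * (1 - s) + b * s) * (c - a * (1 - s) + b * s) := by
    have e : (c + a * (1 - s) + b * s) * (c - a * (1 - s) + b * s) - s * (b + c) ^ 2 =
        (1 - s) * ((c - b) * (c + b) + (b ^ 2 - a ^ 2) * (1 - s)) := by ring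
    have : 0 ≤ (1 - s) * ((c - b) * (c + b) + (b ^ 2 - a ^ 2) * (1 - s)) := by
      refine mul_nonneg hs1.le (add_nonneg (mul_nonneg ?_ ?_) (mul_nonneg ?_ hs1.le))
      · linarith
      · linarith
      · nlinarith
    linarith
  have h3 := mul_le_mul h2 h1 (mul_nonneg hs1.le (by linarith))
    (le_trans (mul_nonneg hs0.le (sq_nonneg _)) h2)
  have h4 := mul_pos (mul_pos hs0 hs1) (sub_pos.2 (cubic_bound ha hab hbc hac hc))
  rw [key]
  nlinarith

/-- At a root, `k w (w - 1) = 4XYZ` eliminates `k`: the derivative times `w (w - 1)` becomes a sum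
of nonnegative products, one of them positive. -/
theorem pencilCubic_deriv_pos {a b c w : ℝ} (ha : 0 < a) (hab : a < b) (hbc : b ≤ c)
    (hk : 0 < 2 * (a + b + c) - 1) (hw : 1 < w) (h : pencilCubic a b c (-w) = 0) :
    0 < 3 * pencilCoeffThree a b * (-w) ^ 2 + 2 * pencilCoeffTwo a b c * (-w) +
      pencilCoeffTwo a c b := by
  set k := 2 * (a + b + c) - 1 with hkdef
  set X := (a + b) * w - (a + c) with hX
  set Y := (a + c) + (b - a) * w with hY
  set Z := (a + b) * w + (c - a) with hZ
  have hw1 : 0 < w - 1 := by linarith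
  have hY0 : 0 < Y := by rw [hY]; nlinarith
  have hZ0 : 0 < Z := by rw [hZ]; nlinarith
  have e0 : k * (w * (w - 1)) = 4 * (X * (Y * Z)) := by
    have : pencilCubic a b c (-w) = k * (w * (w - 1)) - 4 * (X * (Y * Z)) := by
      unfold pencilCubic; ring
    linarith
  have hX0 : 0 < X := by
    by_contra! hX0
    have h1 : 0 < k * (w * (w - 1)) := by positivity
    have h2 := mul_nonpos_of_nonpos_of_nonneg hX0 (mul_pos hY0 hZ0).le
    linarith
  have e1 : 3 * pencilCoeffThree a b * (-w) ^ 2 + 2 * pencilCoeffTwo a b c * (-w) +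
      pencilCoeffTwo a c b =
      4 * ((a + b) * (Y * Z) + (b - a) * (X * Z) + (a + b) * (X * Y)) - k * (2 * w - 1) := by
    unfold pencilCoeffThree pencilCoeffTwo; ring
  have e2 : (4 * ((a + b) * (Y * Z) + (b - a) * (X * Z) + (a + b) * (X * Y)) - k * (2 * w - 1)) *
      (w * (w - 1)) = 4 * ((c - b) * (Y * (w * Z - X * (w - 1))) +
        (b - a) * (X * ((w - 1) * (w * Z - Y)))) := by
    have : (4 * ((a + b) * (Y * Z) + (b - a) * (X * Z) + (a + b) * (X * Y)) - k * (2 * w - 1)) *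
      (w * (w - 1)) = 4 * ((a + b) * (Y * Z) + (b - a) * (X * Z) + (a + b) * (X * Y)) *
        (w * (w - 1)) - 4 * (X * (Y * Z)) * (2 * w - 1) := by rw [← e0]; ring
    rw [this, hX, hY, hZ]; ring
  have h1 : 0 ≤ w * Z - X * (w - 1) := by
    have : X ≤ Z := by rw [hX, hZ]; linarith
    nlinarith
  have h2 : 0 < w * Z - Y := by
    have : w * Z - Y = (w - 1) * ((a + b) * (w + 1) + (c - b)) := by rw [hZ, hY]; ring
    rw [this]
    exact mul_pos hw1 (by nlinarith)
  have h3 : 0 < (b - a) * (X * ((w - 1) * (w * Z - Y))) :=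
    mul_pos (by linarith) (mul_pos hX0 (mul_pos hw1 h2))
  have h4 : 0 ≤ (c - b) * (Y * (w * Z - X * (w - 1))) :=
    mul_nonneg (by linarith) (mul_nonneg hY0.le h1)
  rw [e1]
  by_contra! h5
  have := mul_nonpos_of_nonpos_of_nonneg h5 (mul_pos (by linarith : 0 < w) hw1).le
  linarith

theorem pencilCubic_deriv_neg_one_pos {a b : ℝ} (ha : 0 < a) (hab : a < b) :
    0 < 3 * pencilCoeffThree a b * (-1) ^ 2 + 2 * pencilCoeffTwo a b b * (-1) +
      pencilCoeffTwo a b b := by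
  have hb : 0 < b := ha.trans hab
  have e : b * (3 * pencilCoeffThree a b * (-1) ^ 2 + 2 * pencilCoeffTwo a b b * (-1) +
      pencilCoeffTwo a b b) = (b - a) * (16 * b ^ 3 - 4 * b + 1) +
      a * ((4 * b - 1) ^ 2 * (2 * b + 1)) := by
    unfold pencilCoeffThree pencilCoeffTwo; ring
  have h1 : 0 < 16 * b ^ 3 - 4 * b + 1 := by
    nlinarith [mul_nonneg hb.le (sq_nonneg (b - 3 / 10)), sq_nonneg (b - 3 / 10)]
  have h2 := mul_pos (sub_pos.2 hab) h1
  have h3 : 0 ≤ a * ((4 * b - 1) ^ 2 * (2 * b + 1)) := by positivity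
  by_contra! h
  have := mul_nonpos_of_nonneg_of_nonpos hb.le h
  linarith

/-- At `z = c / b` the last two linear factors coincide, so their product is a square and the cubic
would be negative if `2 s₁ ≤ 1`. -/
theorem sum_gt_half_of_pencilCubic_nonneg {a b c : ℝ} (ha : 0 < a) (hb : 0 < b) (hc : 0 < c)
    (h : ∀ z > 0, 0 ≤ pencilCubic a b c z) : 0 < 2 * (a + b + c) - 1 := by
  have hz : 0 < c / b := by positivity
  have h1 := h _ hz
  have e : b * (c / b) = c := by field_simp
  by_contra! hk
  have h2 : pencilCubic a b c (c / b) = (2 * (a + b + c) - 1) * (c / b * (c / b + 1)) -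
      4 * ((a * (1 + c / b) + c + c) * (a * (1 + c / b)) ^ 2) := by
    unfold pencilCubic; rw [e]; ring
  have h3 := mul_nonpos_of_nonpos_of_nonneg hk (by positivity : 0 ≤ c / b * (c / b + 1))
  have h4 : 0 < (a * (1 + c / b) + c + c) * (a * (1 + c / b)) ^ 2 := by positivity
  linarith

/-- The margin `δ` matters when `a = b`: the cubic may then degenerate to a positive constant, and
`Q = 0` although the cubic is positive. -/
theorem polyQ_pos_of_pencilCubic_ge {a b c δ : ℝ} (ha : 0 < a) (hab : a ≤ b) (hbc : b ≤ c)
    (hc : c < 1 / 2) (hδ : 0 < δ) (h : ∀ z > 0, δ * (z * (z + 1)) ≤ pencilCubic a b c z) :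
    0 < polyQ a b c := by
  have hD := pencilCoeffThree_nonneg (hab.trans hbc)
  have hpos : ∀ z > 0, 0 < pencilCubic a b c z := fun z hz =>
    lt_of_lt_of_le (by positivity) (h z hz)
  have hk := sum_gt_half_of_pencilCubic_nonneg ha (ha.trans_le hab)
    (ha.trans_le (hab.trans hbc)) fun z hz => (hpos z hz).le
  rcases hab.eq_or_lt with rfl | hab'
  · have hB : 0 < pencilCoeffTwo a a c := by
      by_contra! hB
      -- Chosen so that `δ * z` already exceeds the constant term.
      have hz : 0 < 1 + pencilCoeffThree a c / δ := by positivity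
      have h1 := h _ hz
      rw [pencilCubic_of_eq] at h1
      have e : δ * (1 + pencilCoeffThree a c / δ) = δ + pencilCoeffThree a c := by field_simp
      have h2 := mul_nonpos_of_nonpos_of_nonneg hB
        (by positivity : 0 ≤ (1 + pencilCoeffThree a c / δ) ^ 2 + (1 + pencilCoeffThree a c / δ))
      have h3 : 0 ≤ (δ + pencilCoeffThree a c) * (1 + pencilCoeffThree a c / δ) := by positivity
      nlinarith
    have hac : a < c := by
      rcases hbc.eq_or_lt with rfl | h'
      · have e : pencilCoeffTwo a a a = -((4 * a - 1) ^ 2 * (2 * a + 1)) := by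
          unfold pencilCoeffTwo; ring
        have : 0 ≤ (4 * a - 1) ^ 2 * (2 * a + 1) := by positivity
        linarith
      · exact h'
    -- The value at `-1/2` is the constant term minus a quarter of the quadratic coefficient, which
    -- gives the sign of the second factor of `polyQ_of_eq`.
    have h4 := pencilCubic_pos_of_mem_Ioo ha le_rfl hbc hac hc
      (z := -1 / 2) ⟨by norm_num, by norm_num⟩
    rw [pencilCubic_of_eq] at h4
    rw [polyQ_of_eq]
    have := mul_pos (pow_pos hB 3)
      (by linarith : 0 < 4 * pencilCoeffThree a c - pencilCoeffTwo a a c)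
    linarith
  · rw [polyQ_eq_neg_disc, neg_pos]
    apply cubicDisc_neg (pencilCoeffThree_pos ha hab')
    · rw [← pencilCubic_eq, pencilCubic_neg_one]
      exact mul_nonneg (by linarith) (sq_nonneg _)
    · intro z hz
      rw [← pencilCubic_eq]
      rcases lt_trichotomy z 0 with h0 | rfl | h0
      · exact pencilCubic_pos_of_mem_Ioo ha hab hbc (by linarith) hc ⟨hz, h0⟩
      · have := pencilCoeffThree_pos ha (hab'.trans_le hbc)
        rw [pencilCubic_eq]; linarith
      · exact hpos z h0
    · intro z hz hroot
      rw [← pencilCubic_eq] at hroot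
      rcases hz.eq_or_lt with rfl | hz
      · rw [pencilCubic_neg_one] at hroot
        have hcb : c = b := by
          by_contra hne
          have : b < c := lt_of_le_of_ne hbc (Ne.symm hne)
          have : 0 < 4 * (c - b) * (b + c) ^ 2 :=
            mul_pos (by linarith) (pow_pos (by linarith) 2)
          linarith
        subst hcb
        exact pencilCubic_deriv_neg_one_pos ha hab'
      · have := pencilCubic_deriv_pos ha hab' hbc hk (w := -z) (by linarith) (by rwa [neg_neg])
        rwa [neg_neg] at this

/-! ### Inequalities for products of three factors -/

theorem mul_le_cube_sum {x y z : ℝ} (hx : 0 ≤ x) (hy : 0 ≤ y) (hz : 0 ≤ z) :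
    27 * (x * y * z) ≤ (x + y + z) ^ 3 := by
  nlinarith [mul_nonneg hx (sq_nonneg (y - z)), mul_nonneg hy (sq_nonneg (x - z)),
    mul_nonneg hz (sq_nonneg (x - y)), mul_nonneg (add_nonneg (add_nonneg hx hy) hz)
      (add_nonneg (add_nonneg (sq_nonneg (x - y)) (sq_nonneg (y - z))) (sq_nonneg (x - z)))]

theorem three_mul_le_sum {w x y z : ℝ} (hx : 0 ≤ x) (hy : 0 ≤ y) (hz : 0 ≤ z)
    (h : w ^ 3 ≤ x * y * z) : 3 * w ≤ x + y + z := by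
  refine le_of_pow_le_pow_left₀ (n := 3) (by norm_num) (by positivity) ?_
  have := mul_le_cube_sum hx hy hz
  calc (3 * w) ^ 3 = 27 * w ^ 3 := by ring
    _ ≤ 27 * (x * y * z) := by gcongr
    _ ≤ _ := this

/-- Minkowski's inequality for geometric means of three terms, one of them constant. -/
theorem add_pow_three_le_prod_add {w c x y z : ℝ} (hc : 0 ≤ c) (hx : 0 ≤ x) (hy : 0 ≤ y)
    (hz : 0 ≤ z) (hw : 0 ≤ w) (h : w ^ 3 ≤ x * y * z) :
    (c + w) ^ 3 ≤ (c + x) * (c + y) * (c + z) := by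
  have h1 := three_mul_le_sum hx hy hz h
  have h2 : 3 * w ^ 2 ≤ x * y + y * z + x * z := by
    apply three_mul_le_sum (mul_nonneg hx hy) (mul_nonneg hy hz) (mul_nonneg hx hz)
    calc (w ^ 2) ^ 3 = (w ^ 3) ^ 2 := by ring
      _ ≤ (x * y * z) ^ 2 := by gcongr
      _ = _ := by ring
  have h3 := mul_le_mul_of_nonneg_left h1 (sq_nonneg c)
  have h4 := mul_le_mul_of_nonneg_left h2 hc
  nlinarith

/-- For two factors the gap is `μ (1 - μ) (U - X) (V - Y)`, nonnegative when both factors move the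
same way (Chebyshev); nonnegativity allows the third factor. -/
theorem prod_mix_le {A₁ A₂ A₃ B₁ B₂ B₃ μ : ℝ} (h0 : 0 ≤ μ) (h1 : μ ≤ 1)
    (hA₁ : 0 ≤ A₁) (hA₂ : 0 ≤ A₂) (hA₃ : 0 ≤ A₃)
    (h : A₁ ≤ B₁ ∧ A₂ ≤ B₂ ∧ A₃ ≤ B₃) :
    ((1 - μ) * A₁ + μ * B₁) * (((1 - μ) * A₂ + μ * B₂) * ((1 - μ) * A₃ + μ * B₃)) ≤
      (1 - μ) * (A₁ * (A₂ * A₃)) + μ * (B₁ * (B₂ * B₃)) := by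
  have pair : ∀ {X Y U V : ℝ}, X ≤ U → Y ≤ V →
      ((1 - μ) * X + μ * U) * ((1 - μ) * Y + μ * V) ≤ (1 - μ) * (X * Y) + μ * (U * V) := by
    intro X Y U V hX hY
    have := mul_nonneg (mul_nonneg h0 (sub_nonneg.2 h1))
      (mul_nonneg (sub_nonneg.2 hX) (sub_nonneg.2 hY))
    nlinarith
  obtain ⟨h1', h2', h3'⟩ := h
  refine le_trans (mul_le_mul_of_nonneg_left (pair h2' h3') ?_)
    (pair h1' (mul_le_mul h2' h3' hA₃ (hA₂.trans h2')))
  exact add_nonneg (mul_nonneg (sub_nonneg.2 h1) hA₁) (mul_nonneg h0 (hA₁.trans h1'))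

/-! ### Segments towards the diagonal -/

theorem polyQ_segment_neg_of_sorted {a b c r t : ℝ} (ha : 0 < a) (hab : a ≤ b) (hbc : b ≤ c)
    (hc : c < 1 / 2) (hQ : polyQ a b c ≤ 0) (ht : a + b + c = 3 * t) (ht4 : t ≠ 1 / 4)
    (hr0 : 0 ≤ r) (hr1 : r < 1) :
    polyQ (t + r * (a - t)) (t + r * (b - t)) (t + r * (c - t)) < 0 := by
  have ht0 : 0 < t := by linarith
  have hr1' : 0 < 1 - r := by linarith
  have ha' : 0 < t + r * (a - t) := by nlinarith [mul_nonneg hr0 ha.le, mul_pos hr1' ht0]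
  have hab' : t + r * (a - t) ≤ t + r * (b - t) := by gcongr
  have hbc' : t + r * (b - t) ≤ t + r * (c - t) := by gcongr
  by_contra! hQ'
  have hp : ∀ z > 0,
      0 ≤ pencilCubic (t + r * (a - t)) (t + r * (b - t)) (t + r * (c - t)) z := by
    intro z hz
    by_contra! h
    exact absurd (polyQ_neg_of_pencilCubic_neg ha' hab' hbc' hz h) (not_lt.2 hQ')
  have hk := sum_gt_half_of_pencilCubic_nonneg ha' (by linarith) (by linarith) hp
  have hk' : 0 < 6 * t - 1 := by
    have : t + r * (a - t) + (t + r * (b - t)) + (t + r * (c - t)) = 3 * t := by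
      linear_combination r * ht
    rw [this] at hk; linarith
  -- `κ` is the critical geometric mean: the cubic is negative at `z` exactly when the product of
  -- the normalised factors exceeds `κ ^ 3`. It lies below the diagonal value `2t` because `4(2t)³ -
  -- (6t - 1) = (4t - 1)²(2t + 1)`.
  obtain ⟨κ, hκ0, hκ⟩ : ∃ κ : ℝ, 0 < κ ∧ 4 * κ ^ 3 = 6 * t - 1 := by
    refine ⟨((6 * t - 1) / 4) ^ ((3 : ℕ) : ℝ)⁻¹, by positivity, ?_⟩
    rw [Real.rpow_inv_natCast_pow (by positivity) (by norm_num)]; ring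
  have hκt : κ < 2 * t := by
    by_contra! h
    have h1 : (2 * t) ^ 3 ≤ κ ^ 3 := by gcongr
    have h2 : 0 < (4 * t - 1) ^ 2 * (2 * t + 1) :=
      mul_pos (pow_pos (abs_pos.2 (by intro h; apply ht4; linarith : 4 * t - 1 ≠ 0)) 2 |>.trans_eq
        (sq_abs _)) (by linarith)
    nlinarith
  -- The hypothesis `Q ≤ 0` yields only means above any `w < κ`. This `w` is close enough to `κ`
  -- that mixing with `2t` still exceeds `κ`, by at least `(1 - r)²(2t - κ)`.
  obtain ⟨w, hw0, hwκ, hw⟩ : ∃ w, 0 ≤ w ∧ w < κ ∧ κ < (1 - r) * (2 * t) + r * w := by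
    refine ⟨max 0 (κ - (1 - r) * (2 * t - κ)), le_max_left _ _, max_lt hκ0 ?_, ?_⟩
    · have := mul_pos hr1' (sub_pos.2 hκt); linarith
    · have h1 := mul_le_mul_of_nonneg_left (le_max_right 0 (κ - (1 - r) * (2 * t - κ))) hr0
      have h2 := mul_pos (pow_pos hr1' 2) (sub_pos.2 hκt)
      nlinarith
  have hε : 0 < 6 * t - 1 - 4 * w ^ 3 := by
    have : w ^ 3 < κ ^ 3 := by gcongr
    linarith
  obtain ⟨z, hz, hpz⟩ : ∃ z > 0,
      pencilCubic a b c z < (6 * t - 1 - 4 * w ^ 3) * (z * (z + 1)) := by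
    by_contra! h
    exact absurd (polyQ_pos_of_pencilCubic_ge ha hab hbc hc hε h) (not_lt.2 hQ)
  have hz1 : 0 < z + 1 := by linarith
  obtain ⟨α, hα⟩ : ∃ α, a * (1 + z) + b * z + c = (z + 1) * α :=
    ⟨(a * (1 + z) + b * z + c) / (z + 1), by field_simp⟩
  obtain ⟨γ, hγ⟩ : ∃ γ, a * (1 + z) + b * z - c = z * γ :=
    ⟨(a * (1 + z) + b * z - c) / z, by field_simp⟩
  obtain ⟨β, hβ⟩ : ∃ β, a * (1 + z) - b * z + c = β := ⟨_, rfl⟩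
  have hprod : w ^ 3 < α * β * γ := by
    unfold pencilCubic at hpz
    rw [hα, hβ, hγ, show 2 * (a + b + c) - 1 = 6 * t - 1 by linarith] at hpz
    have : (z * (z + 1)) * w ^ 3 < (z * (z + 1)) * (α * β * γ) := by nlinarith
    exact lt_of_mul_lt_mul_left this (by positivity)
  have hα0 : 0 < α := by
    have : 0 < (z + 1) * α := by rw [← hα]; have := mul_pos (ha.trans_le hab) hz; nlinarith
    exact pos_of_mul_pos_right this hz1.le
  have hβγ : 0 < β * γ := by
    have : 0 < α * (β * γ) := by
      have := pow_nonneg hw0 3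
      linarith
    exact pos_of_mul_pos_right this hα0.le
  have hβ0 : 0 < β := by
    by_contra! h
    have hγ0 : γ ≤ 0 := by
      by_contra! h'
      have := mul_nonpos_of_nonpos_of_nonneg h h'.le
      linarith
    have := mul_nonpos_of_nonneg_of_nonpos hz.le hγ0
    have := mul_pos ha hz
    linarith
  have hγ0 : 0 < γ := pos_of_mul_pos_right hβγ hβ0.le
  have hmink := add_pow_three_le_prod_add (w := r * w) (c := (1 - r) * (2 * t))
    (by positivity) (mul_nonneg hr0 hα0.le) (mul_nonneg hr0 hβ0.le) (mul_nonneg hr0 hγ0.le)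
    (by positivity) (by
      calc (r * w) ^ 3 = r ^ 3 * w ^ 3 := by ring
        _ ≤ r ^ 3 * (α * β * γ) := by gcongr
        _ = _ := by ring)
  have hlt : κ ^ 3 < ((1 - r) * (2 * t) + r * w) ^ 3 := by gcongr
  have e : pencilCubic (t + r * (a - t)) (t + r * (b - t)) (t + r * (c - t)) z =
      (6 * t - 1 - 4 * (((1 - r) * (2 * t) + r * α) * ((1 - r) * (2 * t) + r * β) *
        ((1 - r) * (2 * t) + r * γ))) * (z * (z + 1)) := by
    have e1 : (t + r * (a - t)) * (1 + z) + (t + r * (b - t)) * z + (t + r * (c - t)) =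
        (z + 1) * ((1 - r) * (2 * t) + r * α) := by linear_combination r * hα
    have e2 : (t + r * (a - t)) * (1 + z) - (t + r * (b - t)) * z + (t + r * (c - t)) =
        ((1 - r) * (2 * t) + r * β) := by linear_combination r * hβ
    have e3 : (t + r * (a - t)) * (1 + z) + (t + r * (b - t)) * z - (t + r * (c - t)) =
        z * ((1 - r) * (2 * t) + r * γ) := by linear_combination r * hγ
    unfold pencilCubic
    rw [e1, e2, e3]
    linear_combination 2 * (z * (z + 1)) * r * ht
  have hfin := hp z hz
  rw [e] at hfin
  have : 0 ≤ 6 * t - 1 - 4 * (((1 - r) * (2 * t) + r * α) * ((1 - r) * (2 * t) + r * β) *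
        ((1 - r) * (2 * t) + r * γ)) := nonneg_of_mul_nonneg_left hfin (by positivity)
  linarith

/-! ### The slice `s₁ = 3/4` and chords into it -/

/-- AM-GM: the normalised factors sum to at most `5/4 + a < 3/2`, and `4/27 * (3/2)³ = 1/2` is the
value of `2 s₁ - 1` on this slice. Truncation at `0` keeps the factors nonnegative, as `prod_mix_le`
needs. -/
theorem slice_gap_of_sorted {a b c : ℝ} (ha : 0 < a) (hab : a ≤ b) (hbc : b ≤ c)
    (hs : a + b + c = 3 / 4) (ha4 : a < 1 / 4) :
    ∃ δ > 0, ∀ z > 0, 4 * ((a * (1 + z) + b * z + c) * (max (a * (1 + z) - b * z + c) 0 *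
      max (a * (1 + z) + b * z - c) 0)) ≤ (1 / 2 - δ) * (z * (z + 1)) := by
  refine ⟨1 / 2 - 4 / 27 * (5 / 4 + a) ^ 3, ?_, ?_⟩
  · have : (5 / 4 + a) ^ 3 < (3 / 2) ^ 3 := by gcongr; linarith
    linarith
  intro z hz
  have hz1 : 0 < z + 1 := by linarith
  rw [sub_sub_cancel]
  have hR : 0 ≤ 4 / 27 * (5 / 4 + a) ^ 3 * (z * (z + 1)) := by positivity
  rcases le_total (a * (1 + z) - b * z + c) 0 with h | hβ0
  · rw [max_eq_right h]; simpa using hR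
  rcases le_total (a * (1 + z) + b * z - c) 0 with h | hγ0
  · rw [max_eq_right h]; simpa using hR
  rw [max_eq_left hβ0, max_eq_left hγ0]
  have hα0 : 0 ≤ (a * (1 + z) + b * z + c) / (z + 1) := by
    have := mul_pos (ha.trans_le hab) hz
    have := mul_pos ha hz
    exact div_nonneg (by nlinarith) hz1.le
  have h1 := mul_le_cube_sum hα0 hβ0 (div_nonneg hγ0 hz.le)
  have hsum : (a * (1 + z) + b * z + c) / (z + 1) + (a * (1 + z) - b * z + c) +
      (a * (1 + z) + b * z - c) / z ≤ 5 / 4 + a := by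
    have e : (a * (1 + z) + b * z + c) / (z + 1) + (a * (1 + z) - b * z + c) +
      (a * (1 + z) + b * z - c) / z = 3 / 4 + 3 * a - (b - a) * (z - z / (z + 1)) -
        (c - a) * (1 / z - 1 / (z + 1)) := by
      have : c = 3 / 4 - a - b := by linarith
      subst this
      field_simp
      ring
    have h2 : 0 ≤ z - z / (z + 1) := by
      have : z / (z + 1) ≤ z := div_le_self hz.le (by linarith)
      linarith
    have h3 : 0 ≤ 1 / z - 1 / (z + 1) := by
      have : 1 / (z + 1) ≤ 1 / z := one_div_le_one_div_of_le hz (by linarith)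
      linarith
    have h4 := mul_nonneg (sub_nonneg.2 hab) h2
    have h5 := mul_nonneg (sub_nonneg.2 (hab.trans hbc)) h3
    rw [e]; linarith
  have hpow : ((a * (1 + z) + b * z + c) / (z + 1) + (a * (1 + z) - b * z + c) +
      (a * (1 + z) + b * z - c) / z) ^ 3 ≤ (5 / 4 + a) ^ 3 := by
    have : 0 ≤ (a * (1 + z) + b * z - c) / z := div_nonneg hγ0 hz.le
    gcongr
  have e2 : (a * (1 + z) + b * z + c) * ((a * (1 + z) - b * z + c) * (a * (1 + z) + b * z - c)) =
      (a * (1 + z) + b * z + c) / (z + 1) * (a * (1 + z) - b * z + c) *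
      ((a * (1 + z) + b * z - c) / z) * (z * (z + 1)) := by field_simp
  rw [e2]
  have := mul_le_mul_of_nonneg_right (h1.trans hpow) (by positivity : 0 ≤ z * (z + 1))
  linarith

theorem mul_le_max_mul_max {x y : ℝ} (hxy : 0 < x + y) : x * y ≤ max x 0 * max y 0 := by
  rcases le_total x 0 with h | h
  · rw [max_eq_right h, zero_mul]
    exact mul_nonpos_of_nonpos_of_nonneg h (by linarith)
  rcases le_total y 0 with h' | h'
  · rw [max_eq_right h', mul_zero]
    exact mul_nonpos_of_nonneg_of_nonpos h h'
  rw [max_eq_left h, max_eq_left h']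

/-- The terms `2 s₁ - 1` are affine along the chord, and the product of truncated factors is at most
its linear interpolation by `prod_mix_le`. Truncation loses nothing since the two signed factors
have positive sum. -/
theorem pencilCubic_mix_ge {a b c a' b' c' z μ d : ℝ} (ha : 0 < a) (hb : 0 < b) (hc : 0 < c)
    (ha' : 0 < a') (hb' : 0 < b') (hc' : 0 < c') (hz : 0 < z) (hμ0 : 0 ≤ μ) (hμ1 : μ ≤ 1)
    (hk : 0 ≤ 2 * (a + b + c) - 1) (hp : 0 ≤ pencilCubic a b c z)
    (hp' : 4 * ((a' * (1 + z) + b' * z + c') * (max (a' * (1 + z) - b' * z + c') 0 *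
      max (a' * (1 + z) + b' * z - c') 0)) ≤ (2 * (a' + b' + c') - 1) * (z * (z + 1)) - d)
    (hmono : (a * (1 + z) + b * z + c ≤ a' * (1 + z) + b' * z + c' ∧
        max (a * (1 + z) - b * z + c) 0 ≤ max (a' * (1 + z) - b' * z + c') 0 ∧
        max (a * (1 + z) + b * z - c) 0 ≤ max (a' * (1 + z) + b' * z - c') 0) ∨
      (a' * (1 + z) + b' * z + c' ≤ a * (1 + z) + b * z + c ∧
        max (a' * (1 + z) - b' * z + c') 0 ≤ max (a * (1 + z) - b * z + c) 0 ∧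
        max (a' * (1 + z) + b' * z - c') 0 ≤ max (a * (1 + z) + b * z - c) 0)) :
    μ * d ≤ pencilCubic ((1 - μ) * a + μ * a') ((1 - μ) * b + μ * b')
      ((1 - μ) * c + μ * c') z := by
  set α := a * (1 + z) + b * z + c with hα
  set β := a * (1 + z) - b * z + c with hβ
  set γ := a * (1 + z) + b * z - c with hγ
  set α' := a' * (1 + z) + b' * z + c' with hα'
  set β' := a' * (1 + z) - b' * z + c' with hβ'
  set γ' := a' * (1 + z) + b' * z - c' with hγ'
  have hα0 : 0 < α := by positivity
  have hα0' : 0 < α' := by positivity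
  have hβγ : 0 < β + γ := by
    have : β + γ = 2 * a * (1 + z) := by ring
    rw [this]; positivity
  have hβγ' : 0 < β' + γ' := by
    have : β' + γ' = 2 * a' * (1 + z) := by ring
    rw [this]; positivity
  have hμ1' : 0 ≤ 1 - μ := by linarith
  have hzz : 0 < z * (z + 1) := by positivity
  have h0 : 4 * (α * (max β 0 * max γ 0)) ≤ (2 * (a + b + c) - 1) * (z * (z + 1)) := by
    have hR : 0 ≤ (2 * (a + b + c) - 1) * (z * (z + 1)) := mul_nonneg hk hzz.le
    rcases le_total β 0 with h | hβ0
    · rw [max_eq_right h]; simpa using hR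
    rcases le_total γ 0 with h | hγ0
    · rw [max_eq_right h]; simpa using hR
    rw [max_eq_left hβ0, max_eq_left hγ0]
    unfold pencilCubic at hp
    linarith
  have hmix : ((1 - μ) * α + μ * α') * (((1 - μ) * max β 0 + μ * max β' 0) *
      ((1 - μ) * max γ 0 + μ * max γ' 0)) ≤
      (1 - μ) * (α * (max β 0 * max γ 0)) + μ * (α' * (max β' 0 * max γ' 0)) := by
    rcases hmono with h | h
    · exact prod_mix_le hμ0 hμ1 hα0.le (le_max_right _ _) (le_max_right _ _) h
    · have := prod_mix_le (μ := 1 - μ) hμ1' (by linarith) hα0'.le (le_max_right _ _)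
        (le_max_right _ _) h
      rw [sub_sub_cancel] at this
      linarith
  have hmax : ∀ x y : ℝ, max ((1 - μ) * x + μ * y) 0 ≤ (1 - μ) * max x 0 + μ * max y 0 := by
    intro x y
    refine max_le ?_ (add_nonneg (mul_nonneg hμ1' (le_max_right _ _))
      (mul_nonneg hμ0 (le_max_right _ _)))
    gcongr <;> exact le_max_left _ _
  have hsum : 0 < ((1 - μ) * β + μ * β') + ((1 - μ) * γ + μ * γ') := by
    rcases hμ0.eq_or_lt with rfl | h
    · linarith
    · have h1 := mul_nonneg hμ1' hβγ.le
      have h2 := mul_pos h hβγ'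
      linarith
  have hα'' : 0 ≤ (1 - μ) * α + μ * α' :=
    add_nonneg (mul_nonneg hμ1' hα0.le) (mul_nonneg hμ0 hα0'.le)
  have hchain : ((1 - μ) * α + μ * α') * (((1 - μ) * β + μ * β') * ((1 - μ) * γ + μ * γ')) ≤
      (1 - μ) * (α * (max β 0 * max γ 0)) + μ * (α' * (max β' 0 * max γ' 0)) := by
    refine le_trans (mul_le_mul_of_nonneg_left ((mul_le_max_mul_max hsum).trans ?_) hα'') hmix
    exact mul_le_mul (hmax _ _) (hmax _ _) (le_max_right _ _)
      ((le_max_right _ _).trans (hmax _ _))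
  have e : pencilCubic ((1 - μ) * a + μ * a') ((1 - μ) * b + μ * b') ((1 - μ) * c + μ * c') z =
      (1 - μ) * ((2 * (a + b + c) - 1) * (z * (z + 1))) +
      μ * ((2 * (a' + b' + c') - 1) * (z * (z + 1))) -
      4 * (((1 - μ) * α + μ * α') * (((1 - μ) * β + μ * β') * ((1 - μ) * γ + μ * γ'))) := by
    rw [hα, hβ, hγ, hα', hβ', hγ']; unfold pencilCubic; ring
  rw [e]
  have h1 := mul_le_mul_of_nonneg_left h0 hμ1'
  have h2 := mul_le_mul_of_nonneg_left hp' hμ0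
  linarith

theorem exists_chord_of_sorted {a b c : ℝ} (ha : 0 < a) (hab : a ≤ b) (hbc : b ≤ c)
    (hc : c < 1 / 2) (hQ : 0 ≤ polyQ a b c) (hne : ¬ (a = 1 / 4 ∧ b = 1 / 4 ∧ c = 1 / 4)) :
    ∃ a' b' c' : ℝ, (0 < a' ∧ a' < 1 / 2) ∧ (0 < b' ∧ b' < 1 / 2) ∧ (0 < c' ∧ c' < 1 / 2) ∧
      a' + b' + c' = 3 / 4 ∧ ¬ (a' = 1 / 4 ∧ b' = 1 / 4 ∧ c' = 1 / 4) ∧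
      ∀ μ : ℝ, 0 < μ → μ ≤ 1 → 0 < polyQ ((1 - μ) * a + μ * a') ((1 - μ) * b + μ * b')
        ((1 - μ) * c + μ * c') := by
  have hac : a < c := by
    rcases (hab.trans hbc).eq_or_lt with rfl | h
    · obtain rfl : b = a := le_antisymm hbc hab
      exfalso
      rw [polyQ_diag] at hQ
      have h0 : 4 * b - 1 ≠ 0 := fun h => hne ⟨by linarith, by linarith, by linarith⟩
      have h1 : 2 * b + 1 ≠ 0 := by positivity
      have : 0 < ((4 * b - 1) ^ 2 * (2 * b + 1)) ^ 4 := by positivity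
      linarith
    · exact h
  have hp : ∀ z > 0, 0 ≤ pencilCubic a b c z := by
    intro z hz
    by_contra! h
    exact absurd (polyQ_neg_of_pencilCubic_neg ha hab hbc hz h) (not_lt.2 hQ)
  have hb : 0 < b := ha.trans_le hab
  have hc0 : 0 < c := hb.trans_le hbc
  have hk := sum_gt_half_of_pencilCubic_nonneg ha hb hc0 hp
  suffices H : ∃ a' b' c' : ℝ, 0 < a' ∧ a' ≤ b' ∧ b' ≤ c' ∧ c' < 1 / 2 ∧ a' < c' ∧
      a' + b' + c' = 3 / 4 ∧ ∀ z > 0,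
      ((a * (1 + z) + b * z + c ≤ a' * (1 + z) + b' * z + c' ∧
        max (a * (1 + z) - b * z + c) 0 ≤ max (a' * (1 + z) - b' * z + c') 0 ∧
        max (a * (1 + z) + b * z - c) 0 ≤ max (a' * (1 + z) + b' * z - c') 0) ∨
      (a' * (1 + z) + b' * z + c' ≤ a * (1 + z) + b * z + c ∧
        max (a' * (1 + z) - b' * z + c') 0 ≤ max (a * (1 + z) - b * z + c) 0 ∧
        max (a' * (1 + z) + b' * z - c') 0 ≤ max (a * (1 + z) + b * z - c) 0)) by
    obtain ⟨a', b', c', ha', hab', hbc', hc', hac', hs, hmono⟩ := H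
    refine ⟨a', b', c', ⟨ha', by linarith⟩, ⟨by linarith, by linarith⟩, ⟨by linarith, hc'⟩, hs,
      fun h => by linarith [h.1, h.2.2], fun μ hμ0 hμ1 => ?_⟩
    obtain ⟨δ, hδ, hgap⟩ := slice_gap_of_sorted ha' hab' hbc' hs (by linarith)
    have hμ1' : 0 ≤ 1 - μ := by linarith
    refine polyQ_pos_of_pencilCubic_ge (δ := μ * δ) ?_ ?_ ?_ ?_ (mul_pos hμ0 hδ) ?_
    · have := mul_nonneg hμ1' ha.le
      have := mul_pos hμ0 ha'
      linarith
    · gcongr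
    · gcongr
    · have h1 := mul_le_mul_of_nonneg_left hc.le hμ1'
      have h2 := mul_lt_mul_of_pos_left hc' hμ0
      linarith
    · intro z hz
      have := pencilCubic_mix_ge (d := δ * (z * (z + 1))) ha hb hc0 ha' (by linarith)
        (by linarith) hz hμ0.le hμ1 hk.le (hp z hz)
        (by have := hgap z hz; rw [hs]; linarith) (hmono z hz)
      linarith
  rcases le_total (a + b + c) (3 / 4) with hs | hs
  -- Below the slice: a homothety centred at the corner `(1/2, 1/2, 1/2)` raises the sum to `3/4`,
  -- and sortedness makes all three factors grow.
  · set l := (3 / 4 - (a + b + c)) / (3 / 2 - (a + b + c)) with hl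
    have hden : 0 < 3 / 2 - (a + b + c) := by linarith
    have hl0 : 0 ≤ l := div_nonneg (by linarith) hden.le
    have hl1 : l < 1 := by rw [hl, div_lt_one hden]; linarith
    have hle : l * (3 / 2 - (a + b + c)) = 3 / 4 - (a + b + c) := by
      rw [hl]; exact div_mul_cancel₀ _ hden.ne'
    have hl1' : 0 < 1 - l := by linarith
    refine ⟨a + l * (1 / 2 - a), b + l * (1 / 2 - b), c + l * (1 / 2 - c), ?_, ?_, ?_, ?_, ?_, ?_,
      fun z hz => Or.inl ⟨?_, max_le_max_right _ ?_, max_le_max_right _ ?_⟩⟩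
    · have := mul_nonneg hl0 (by linarith : 0 ≤ 1 / 2 - a); linarith
    · nlinarith [mul_nonneg hl1'.le (sub_nonneg.2 hab)]
    · nlinarith [mul_nonneg hl1'.le (sub_nonneg.2 hbc)]
    · nlinarith [mul_pos hl1' (sub_pos.2 hc)]
    · nlinarith [mul_pos hl1' (sub_pos.2 hac)]
    · linarith
    · have : 0 ≤ l * ((1 / 2 - a) * (1 + z) + (1 / 2 - b) * z + (1 / 2 - c)) :=
        mul_nonneg hl0 (by
          have := mul_nonneg (by linarith : 0 ≤ 1 / 2 - a) hz.le
          have := mul_nonneg (by linarith : 0 ≤ 1 / 2 - b) hz.le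
          linarith)
      linarith
    · have : 0 ≤ l * ((1 / 2 - a) + (b - a) * z + (1 / 2 - c)) :=
        mul_nonneg hl0 (by
          have := mul_nonneg (sub_nonneg.2 hab) hz.le
          linarith)
      linarith
    · have : 0 ≤ l * ((1 / 2 - a) * z + (1 / 2 - b) * z + (c - a)) :=
        mul_nonneg hl0 (by
          have := mul_nonneg (by linarith : 0 ≤ 1 / 2 - a) hz.le
          have := mul_nonneg (by linarith : 0 ≤ 1 / 2 - b) hz.le
          linarith)
      linarith
  -- Above the slice: scaling towards the origin, which shrinks all three truncated factors.
  · set l := (3 / 4) / (a + b + c) with hl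
    have hden : 0 < a + b + c := by linarith
    have hl0 : 0 < l := div_pos (by norm_num) hden
    have hl1 : l ≤ 1 := by rw [hl, div_le_one hden]; linarith
    have hle : l * (a + b + c) = 3 / 4 := by rw [hl]; field_simp
    have hscale : ∀ x : ℝ, max (l * x) 0 ≤ max x 0 := by
      intro x
      refine max_le ?_ (le_max_right _ _)
      calc l * x ≤ l * max x 0 := by gcongr; exact le_max_left _ _
        _ ≤ 1 * max x 0 := by gcongr
        _ = _ := one_mul _
    refine ⟨l * a, l * b, l * c, by positivity, by gcongr, by gcongr, ?_, by gcongr, by linarith,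
      fun z hz => Or.inr ⟨?_, ?_, ?_⟩⟩
    · calc l * c ≤ 1 * c := by gcongr
        _ < _ := by linarith
    · have : 0 ≤ (1 - l) * (a * (1 + z) + b * z + c) :=
        mul_nonneg (by linarith) (by positivity)
      linarith
    · have := hscale (a * (1 + z) - b * z + c)
      rwa [show l * (a * (1 + z) - b * z + c) = l * a * (1 + z) - l * b * z + l * c by ring] at this
    · have := hscale (a * (1 + z) + b * z - c)
      rwa [show l * (a * (1 + z) + b * z - c) = l * a * (1 + z) + l * b * z - l * c by ring] at this

/-! ### Removing the ordering assumption -/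

/-- A property invariant under permutations of three reals may be checked on ordered triples. -/
theorem forall_of_sorted {P : ℝ → ℝ → ℝ → Prop} (h₁₂ : ∀ a b c, P a b c → P b a c)
    (h₂₃ : ∀ a b c, P a b c → P a c b) (h : ∀ a b c, a ≤ b → b ≤ c → P a b c) (a b c : ℝ) :
    P a b c := by
  rcases le_total a b with h1 | h1 <;> rcases le_total b c with h2 | h2 <;>
    rcases le_total a c with h3 | h3
  · exact h _ _ _ h1 h2
  · exact h _ _ _ h1 h2
  · exact h₂₃ _ _ _ (h _ _ _ h3 h2)
  · exact h₂₃ _ _ _ (h₁₂ _ _ _ (h _ _ _ h3 h1))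
  · exact h₁₂ _ _ _ (h _ _ _ h1 h3)
  · exact h₁₂ _ _ _ (h₂₃ _ _ _ (h _ _ _ h2 h3))
  · exact h₁₂ _ _ _ (h₂₃ _ _ _ (h₁₂ _ _ _ (h _ _ _ h2 h1)))
  · exact h₁₂ _ _ _ (h₂₃ _ _ _ (h₁₂ _ _ _ (h _ _ _ h2 h1)))

theorem polyQ_segment_neg {a b c : ℝ} (ha : 0 < a ∧ a < 1 / 2) (hb : 0 < b ∧ b < 1 / 2)
    (hc : 0 < c ∧ c < 1 / 2) (hQ : polyQ a b c ≤ 0) {r t : ℝ} (ht : a + b + c = 3 * t)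
    (ht4 : t ≠ 1 / 4) (hr0 : 0 ≤ r) (hr1 : r < 1) :
    polyQ (t + r * (a - t)) (t + r * (b - t)) (t + r * (c - t)) < 0 := by
  revert ha hb hc hQ ht
  refine forall_of_sorted (P := fun a b c => 0 < a ∧ a < 1 / 2 → 0 < b ∧ b < 1 / 2 →
    0 < c ∧ c < 1 / 2 → polyQ a b c ≤ 0 → a + b + c = 3 * t →
    polyQ (t + r * (a - t)) (t + r * (b - t)) (t + r * (c - t)) < 0) ?_ ?_ ?_ a b c
  · intro a b c h hb ha hc hQ ht
    rw [polyQ_swap₁₂] at hQ ⊢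
    exact h ha hb hc hQ (by linarith)
  · intro a b c h ha hc hb hQ ht
    rw [polyQ_swap₂₃] at hQ ⊢
    exact h ha hb hc hQ (by linarith)
  · intro a b c hab hbc ha hb hc hQ ht
    exact polyQ_segment_neg_of_sorted ha.1 hab hbc hc.2 hQ ht ht4 hr0 hr1

theorem exists_chord {a b c : ℝ} (ha : 0 < a ∧ a < 1 / 2) (hb : 0 < b ∧ b < 1 / 2)
    (hc : 0 < c ∧ c < 1 / 2) (hQ : 0 ≤ polyQ a b c)
    (hne : ¬ (a = 1 / 4 ∧ b = 1 / 4 ∧ c = 1 / 4)) :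
    ∃ a' b' c' : ℝ, (0 < a' ∧ a' < 1 / 2) ∧ (0 < b' ∧ b' < 1 / 2) ∧ (0 < c' ∧ c' < 1 / 2) ∧
      a' + b' + c' = 3 / 4 ∧ ¬ (a' = 1 / 4 ∧ b' = 1 / 4 ∧ c' = 1 / 4) ∧
      ∀ μ : ℝ, 0 < μ → μ ≤ 1 → 0 < polyQ ((1 - μ) * a + μ * a') ((1 - μ) * b + μ * b')
        ((1 - μ) * c + μ * c') := by
  revert ha hb hc hQ hne
  refine forall_of_sorted (P := fun a b c => 0 < a ∧ a < 1 / 2 → 0 < b ∧ b < 1 / 2 →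
    0 < c ∧ c < 1 / 2 → 0 ≤ polyQ a b c → ¬ (a = 1 / 4 ∧ b = 1 / 4 ∧ c = 1 / 4) →
    ∃ a' b' c' : ℝ, (0 < a' ∧ a' < 1 / 2) ∧ (0 < b' ∧ b' < 1 / 2) ∧ (0 < c' ∧ c' < 1 / 2) ∧
      a' + b' + c' = 3 / 4 ∧ ¬ (a' = 1 / 4 ∧ b' = 1 / 4 ∧ c' = 1 / 4) ∧
      ∀ μ : ℝ, 0 < μ → μ ≤ 1 → 0 < polyQ ((1 - μ) * a + μ * a') ((1 - μ) * b + μ * b')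
        ((1 - μ) * c + μ * c')) ?_ ?_ ?_ a b c
  · intro a b c h hb ha hc hQ hne
    rw [polyQ_swap₁₂] at hQ
    obtain ⟨a', b', c', h1, h2, h3, h4, h5, h6⟩ := h ha hb hc hQ (by tauto)
    refine ⟨b', a', c', h2, h1, h3, by linarith, by tauto, fun μ hμ0 hμ1 => ?_⟩
    rw [polyQ_swap₁₂]
    exact h6 μ hμ0 hμ1
  · intro a b c h ha hc hb hQ hne
    rw [polyQ_swap₂₃] at hQ
    obtain ⟨a', b', c', h1, h2, h3, h4, h5, h6⟩ := h ha hb hc hQ (by tauto)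
    refine ⟨a', c', b', h1, h3, h2, by linarith, by tauto, fun μ hμ0 hμ1 => ?_⟩
    rw [polyQ_swap₂₃]
    exact h6 μ hμ0 hμ1
  · intro a b c hab hbc ha hb hc hQ hne
    exact exists_chord_of_sorted ha.1 hab hbc hc.2 hQ hne

theorem polyQ_pos_of_sum_eq {a b c : ℝ} (ha : 0 < a ∧ a < 1 / 2) (hb : 0 < b ∧ b < 1 / 2)
    (hc : 0 < c ∧ c < 1 / 2) (hs : a + b + c = 3 / 4)
    (hne : ¬ (a = 1 / 4 ∧ b = 1 / 4 ∧ c = 1 / 4)) : 0 < polyQ a b c := by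
  revert ha hb hc hs hne
  refine forall_of_sorted (P := fun a b c => 0 < a ∧ a < 1 / 2 → 0 < b ∧ b < 1 / 2 →
    0 < c ∧ c < 1 / 2 → a + b + c = 3 / 4 → ¬ (a = 1 / 4 ∧ b = 1 / 4 ∧ c = 1 / 4) →
    0 < polyQ a b c) ?_ ?_ ?_ a b c
  · intro a b c h hb ha hc hs hne
    rw [polyQ_swap₁₂]
    exact h ha hb hc (by linarith) (by tauto)
  · intro a b c h ha hc hb hs hne
    rw [polyQ_swap₂₃]
    exact h ha hb hc (by linarith) (by tauto)
  · intro a b c hab hbc ha hb hc hs hne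
    have ha4 : a < 1 / 4 := by
      by_contra! h
      exact hne ⟨by linarith, by linarith, by linarith⟩
    obtain ⟨δ, hδ, hgap⟩ := slice_gap_of_sorted ha.1 hab hbc hs ha4
    refine polyQ_pos_of_pencilCubic_ge ha.1 hab hbc hc.2 hδ fun z hz => ?_
    have h1 : 0 < (a * (1 + z) - b * z + c) + (a * (1 + z) + b * z - c) := by
      have := mul_pos ha.1 hz
      linarith
    have h2 : 0 ≤ a * (1 + z) + b * z + c := by
      have := mul_pos ha.1 hz
      have := mul_pos hb.1 hz
      linarith
    have h3 := mul_le_mul_of_nonneg_left (mul_le_max_mul_max h1) h2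
    have h4 := hgap z hz
    unfold pencilCubic
    rw [hs]
    linarith

/-! ### Connectedness of the regions `Q < 0`, `Q > 0` and `Q ≥ 0` -/

section Topology

def coordSum (a : Fin 3 → ℝ) : ℝ := a 0 + a 1 + a 2

def polyQVec (a : Fin 3 → ℝ) : ℝ := polyQ (a 0) (a 1) (a 2)

/-- The orthogonal projection onto the diagonal. -/
noncomputable def diagProj (a : Fin 3 → ℝ) : Fin 3 → ℝ := fun _ => coordSum a / 3

noncomputable def quarterPoint : Fin 3 → ℝ := fun _ => 1 / 4

/-- The point of the segment from the diagonal projection of `a` to `a` with parameter `r`. -/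
noncomputable def towardDiag (a : Fin 3 → ℝ) (r : ℝ) : Fin 3 → ℝ := diagProj a + r • (a - diagProj a)

theorem coordSum_vec (x y z : ℝ) : coordSum ![x, y, z] = x + y + z := rfl

theorem polyQVec_vec (x y z : ℝ) : polyQVec ![x, y, z] = polyQ x y z := rfl

theorem continuous_polyQVec : Continuous polyQVec := by
  unfold polyQVec polyQ; fun_prop

theorem continuous_coordSum : Continuous coordSum := by
  unfold coordSum; fun_prop

theorem continuous_towardDiag :
    Continuous fun p : (Fin 3 → ℝ) × ℝ => towardDiag p.1 p.2 := by
  unfold towardDiag diagProj coordSum; fun_prop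

theorem isOpen_openCube : IsOpen openCube := by
  have : openCube = Set.pi Set.univ fun _ : Fin 3 => Set.Ioo (0 : ℝ) (1 / 2) := by
    ext; simp [openCube]
  rw [this]
  exact isOpen_set_pi Set.finite_univ fun _ _ => isOpen_Ioo

theorem convex_openCube : Convex ℝ openCube := by
  have : openCube = Set.pi Set.univ fun _ : Fin 3 => Set.Ioo (0 : ℝ) (1 / 2) := by
    ext; simp [openCube]
  rw [this]
  exact convex_pi fun _ _ => convex_Ioo _ _

theorem coordSum_combo (x y : Fin 3 → ℝ) (p q : ℝ) :
    coordSum (p • x + q • y) = p * coordSum x + q * coordSum y := by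
  simp [coordSum]; ring

theorem convex_coordSum_preimage {S : Set ℝ} (hS : Convex ℝ S) :
    Convex ℝ {a | coordSum a ∈ S} := by
  intro x hx y hy p q hp hq hpq
  simp only [Set.mem_ofPred_eq, coordSum_combo]
  exact hS hx hy hp hq hpq

theorem coordSum_diagProj (a : Fin 3 → ℝ) : coordSum (diagProj a) = coordSum a := by
  simp [coordSum, diagProj]; ring

theorem diagProj_mem {a : Fin 3 → ℝ} (ha : a ∈ openCube) : diagProj a ∈ openCube := by
  intro i
  have h0 := ha 0
  have h1 := ha 1
  have h2 := ha 2
  simp only [diagProj, coordSum, Set.mem_Ioo] at *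
  constructor <;> linarith

theorem towardDiag_zero (a : Fin 3 → ℝ) : towardDiag a 0 = diagProj a := by simp [towardDiag]

theorem towardDiag_one (a : Fin 3 → ℝ) : towardDiag a 1 = a := by simp [towardDiag]

theorem segment_diagProj (a : Fin 3 → ℝ) :
    segment ℝ (diagProj a) a = towardDiag a '' Set.Icc 0 1 := segment_eq_image' ..

theorem towardDiag_mem {a : Fin 3 → ℝ} (ha : a ∈ openCube) {r : ℝ} (hr : r ∈ Set.Icc (0 : ℝ) 1) :
    towardDiag a r ∈ openCube :=
  convex_openCube.segment_subset (diagProj_mem ha) ha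
    (segment_diagProj a ▸ Set.mem_image_of_mem _ hr)

theorem coordSum_towardDiag (a : Fin 3 → ℝ) (r : ℝ) :
    coordSum (towardDiag a r) = coordSum a := by
  simp [coordSum, towardDiag, diagProj]; ring

theorem towardDiag_towardDiag (a : Fin 3 → ℝ) (r s : ℝ) :
    towardDiag (towardDiag a r) s = towardDiag a (s * r) := by
  have : diagProj (towardDiag a r) = diagProj a := by
    unfold diagProj; rw [coordSum_towardDiag]
  rw [towardDiag, this]
  unfold towardDiag
  module

theorem polyQVec_diagProj (a : Fin 3 → ℝ) :
    polyQVec (diagProj a) =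
      -((4 * (coordSum a / 3) - 1) ^ 2 * (2 * (coordSum a / 3) + 1)) ^ 4 :=
  polyQ_diag _

theorem polyQVec_towardDiag_neg {a : Fin 3 → ℝ} (ha : a ∈ openCube) (hQ : polyQVec a ≤ 0)
    (hs : coordSum a ≠ 3 / 4) {r : ℝ} (hr0 : 0 ≤ r) (hr1 : r < 1) :
    polyQVec (towardDiag a r) < 0 := by
  have := polyQ_segment_neg (ha 0) (ha 1) (ha 2) hQ (r := r) (t := coordSum a / 3)
    (by unfold coordSum; ring) (fun h => hs (by linarith)) hr0 hr1
  simpa [polyQVec, towardDiag, diagProj] using this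

theorem ne_quarterPoint {a : Fin 3 → ℝ} (h : a ≠ quarterPoint) :
    ¬ (a 0 = 1 / 4 ∧ a 1 = 1 / 4 ∧ a 2 = 1 / 4) := by
  rintro ⟨h0, h1, h2⟩
  apply h
  ext i
  fin_cases i <;> assumption

theorem polyQVec_pos_of_coordSum_eq {a : Fin 3 → ℝ} (ha : a ∈ openCube)
    (hs : coordSum a = 3 / 4) (hne : a ≠ quarterPoint) : 0 < polyQVec a :=
  polyQ_pos_of_sum_eq (ha 0) (ha 1) (ha 2) hs (ne_quarterPoint hne)

theorem quarterPoint_mem : quarterPoint ∈ openCube := fun _ => by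
  constructor <;> norm_num [quarterPoint]

theorem polyQVec_quarterPoint : polyQVec quarterPoint = 0 := by
  have := polyQ_diag (1 / 4)
  norm_num at this
  simpa [polyQVec, quarterPoint] using this

/-- The part of `{Q < 0}` in the cube on which the coordinate sum lies in a prescribed set. -/
def polyQNegPart (S : Set ℝ) : Set (Fin 3 → ℝ) := {a ∈ openCube | polyQVec a < 0 ∧ coordSum a ∈ S}

def polyQPosPart : Set (Fin 3 → ℝ) := {a ∈ openCube | 0 < polyQVec a}

theorem isOpen_polyQNegPart {S : Set ℝ} (hS : IsOpen S) : IsOpen (polyQNegPart S) :=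
  isOpen_openCube.inter ((isOpen_lt continuous_polyQVec continuous_const).inter
    (hS.preimage continuous_coordSum))

theorem isOpen_polyQPosPart : IsOpen polyQPosPart :=
  isOpen_openCube.inter (isOpen_lt continuous_const continuous_polyQVec)

/-- Each point moves to the diagonal inside its own slice; on the diagonal `Q < 0` except at sum
`3/4`, so the convexity of `S` joins the projections. -/
theorem isPreconnected_polyQNegPart {S : Set ℝ} (hS : Convex ℝ S) (h4 : (3 / 4 : ℝ) ∉ S) :
    IsPreconnected (polyQNegPart S) := by
  rcases (polyQNegPart S).eq_empty_or_nonempty with h | ⟨x, hx⟩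
  · rw [h]; exact isPreconnected_empty
  have toDiag : ∀ y ∈ polyQNegPart S, JoinedIn (polyQNegPart S) (diagProj y) y := by
    intro y hy
    apply JoinedIn.of_segment_subset
    rw [segment_diagProj]
    rintro _ ⟨r, hr, rfl⟩
    refine ⟨towardDiag_mem hy.1 hr, ?_, ?_⟩
    · rcases hr.2.eq_or_lt with rfl | hr1
      · rw [towardDiag_one]; exact hy.2.1
      · exact polyQVec_towardDiag_neg hy.1 hy.2.1.le (fun h => h4 (h ▸ hy.2.2)) hr.1 hr1
    · rw [coordSum_towardDiag]; exact hy.2.2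
  have onDiag : ∀ y ∈ polyQNegPart S, JoinedIn (polyQNegPart S) (diagProj x) (diagProj y) := by
    intro y hy
    apply JoinedIn.of_segment_subset
    intro w hw
    have hwc := convex_openCube.segment_subset (diagProj_mem hx.1) (diagProj_mem hy.1) hw
    have hwS : coordSum w ∈ S := (convex_coordSum_preimage hS).segment_subset
      (by simpa [coordSum_diagProj] using hx.2.2) (by simpa [coordSum_diagProj] using hy.2.2) hw
    refine ⟨hwc, ?_, hwS⟩
    have hwd : w = diagProj w := by
      obtain ⟨p, q, -, -, -, rfl⟩ := hw
      ext i
      simp [diagProj, coordSum]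
      ring
    have h1 : 4 * (coordSum w / 3) - 1 ≠ 0 := fun h => h4 (by
      have : coordSum w = 3 / 4 := by linarith
      exact this ▸ hwS)
    have h2 : 0 < 2 * (coordSum w / 3) + 1 := by
      have h0 := (hwc 0).1
      have h1 := (hwc 1).1
      have h2 := (hwc 2).1
      unfold coordSum
      linarith
    rw [hwd, polyQVec_diagProj, neg_lt_zero]
    positivity
  refine IsPathConnected.isConnected ⟨diagProj x, (toDiag x hx).source_mem, fun {y} hy => ?_⟩
    |>.isPreconnected
  exact (onDiag y hy).trans (toDiag y hy)

theorem joinedIn_polyQPosPart_of_coordSum_eq {a : Fin 3 → ℝ} (ha : a ∈ openCube)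
    (hs : coordSum a = 3 / 4) (hne : a ≠ quarterPoint) :
    JoinedIn polyQPosPart ![1 / 6, 1 / 4, 1 / 3] a := by
  have key : ∀ {x y : Fin 3 → ℝ}, x ∈ openCube → y ∈ openCube → coordSum x = 3 / 4 →
      coordSum y = 3 / 4 → quarterPoint ∉ segment ℝ x y → JoinedIn polyQPosPart x y := by
    intro x y hx hy hxs hys hq
    apply JoinedIn.of_segment_subset
    intro w hw
    have hwc := convex_openCube.segment_subset hx hy hw
    have hws : coordSum w = 3 / 4 :=
      (convex_coordSum_preimage (convex_singleton (3 / 4))).segment_subset hxs hys hw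
    exact ⟨hwc, polyQVec_pos_of_coordSum_eq hwc hws fun h => hq (h ▸ hw)⟩
  have hw₀ : (![1 / 6, 1 / 4, 1 / 3] : Fin 3 → ℝ) ∈ openCube := by
    intro i; fin_cases i <;> norm_num
  have hw₁ : (![1 / 4, 1 / 6, 1 / 3] : Fin 3 → ℝ) ∈ openCube := by
    intro i; fin_cases i <;> norm_num
  have hs₀ : coordSum ![1 / 6, 1 / 4, 1 / 3] = 3 / 4 := by rw [coordSum_vec]; norm_num
  have hs₁ : coordSum ![1 / 4, 1 / 6, 1 / 3] = 3 / 4 := by rw [coordSum_vec]; norm_num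
  -- If the straight segment hits the puncture, then `a 1 = 1/4`, and a detour through `![1/4, 1/6,
  -- 1/3]` works: its first leg keeps third coordinate `1/3`, and its second leg reaches second
  -- coordinate `1/4` only at `a`.
  by_cases hq : quarterPoint ∈ segment ℝ ![1 / 6, 1 / 4, 1 / 3] a
  · have ha1 : a 1 = 1 / 4 := by
      obtain ⟨p, q, hp, hq, hpq, h⟩ := hq
      have h0 := congrFun h 0
      have h1 := congrFun h 1
      simp [quarterPoint] at h0 h1
      have hq0 : q ≠ 0 := by
        rintro rfl
        obtain rfl : p = 1 := by linarith
        norm_num at h0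
      have : q * (a 1 - 1 / 4) = 0 := by linear_combination h1 - (1 / 4) * hpq
      have := (mul_eq_zero.1 this).resolve_left hq0
      linarith
    refine (key hw₀ hw₁ hs₀ hs₁ ?_).trans (key hw₁ ha hs₁ hs ?_)
    · rintro ⟨p, q, hp, hq, hpq, h⟩
      have h2 := congrFun h 2
      simp [quarterPoint] at h2
      linarith
    · rintro ⟨p, q, hp, hq, hpq, h⟩
      have h1 := congrFun h 1
      simp [quarterPoint, ha1] at h1
      obtain rfl : p = 0 := by linarith
      obtain rfl : q = 1 := by linarith
      simp at h
      exact hne h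
  · exact key hw₀ ha hs₀ hs hq

theorem exists_joinedIn_chord {a : Fin 3 → ℝ} (ha : a ∈ openCube) (hQ : 0 ≤ polyQVec a)
    (hne : a ≠ quarterPoint) :
    ∃ b ∈ openCube, coordSum b = 3 / 4 ∧ b ≠ quarterPoint ∧
      ∀ w ∈ segment ℝ a b, w ∈ openCube ∧ (w = a ∨ 0 < polyQVec w) := by
  obtain ⟨a', b', c', h1, h2, h3, h4, h5, h6⟩ :=
    exists_chord (ha 0) (ha 1) (ha 2) hQ (ne_quarterPoint hne)
  have hb : (![a', b', c'] : Fin 3 → ℝ) ∈ openCube := by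
    intro i; fin_cases i
    exacts [h1, h2, h3]
  refine ⟨![a', b', c'], hb, by simpa [coordSum] using h4, ?_, ?_⟩
  · intro h
    exact h5 ⟨congrFun h 0, congrFun h 1, congrFun h 2⟩
  · intro w hw
    refine ⟨convex_openCube.segment_subset ha hb hw, ?_⟩
    obtain ⟨p, q, hp, hq, hpq, rfl⟩ := hw
    obtain rfl : p = 1 - q := by linarith
    rcases hq.eq_or_lt with rfl | hq
    · left; simp
    · right
      simpa [polyQVec] using h6 q hq (by linarith)

theorem isPreconnected_polyQPosPart : IsPreconnected polyQPosPart := by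
  have base : (![1 / 6, 1 / 4, 1 / 3] : Fin 3 → ℝ) ∈ polyQPosPart := by
    refine ⟨fun i => by fin_cases i <;> norm_num, ?_⟩
    rw [polyQVec_vec]; norm_num [polyQ]
  refine IsPathConnected.isConnected ⟨_, base, fun {a} ha => ?_⟩ |>.isPreconnected
  have hne : a ≠ quarterPoint := by
    rintro rfl
    exact absurd ha.2 (by rw [polyQVec_quarterPoint]; exact lt_irrefl 0)
  obtain ⟨b, hb, hbs, hbne, hseg⟩ := exists_joinedIn_chord ha.1 ha.2.le hne
  refine (joinedIn_polyQPosPart_of_coordSum_eq hb hbs hbne).trans (JoinedIn.of_segment_subset ?_).symm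
  intro w hw
  obtain ⟨h1, rfl | h2⟩ := hseg w hw
  exacts [ha, ⟨h1, h2⟩]

def polyQNonnegPart : Set (Fin 3 → ℝ) := {a ∈ openCube | 0 ≤ polyQVec a}

theorem isPreconnected_polyQNonnegPart : IsPreconnected polyQNonnegPart := by
  have hsub : polyQPosPart ⊆ polyQNonnegPart := fun a ha => ⟨ha.1, ha.2.le⟩
  have base : (![1 / 6, 1 / 4, 1 / 3] : Fin 3 → ℝ) ∈ polyQNonnegPart := by
    refine ⟨fun i => by fin_cases i <;> norm_num, ?_⟩
    rw [polyQVec_vec]; norm_num [polyQ]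
  refine IsPathConnected.isConnected ⟨_, base, fun {a} ha => ?_⟩ |>.isPreconnected
  -- The puncture itself has no chord; it is joined to the base point within the slice.
  by_cases hne : a = quarterPoint
  · subst hne
    apply JoinedIn.of_segment_subset
    intro w hw
    have hwc := convex_openCube.segment_subset base.1 ha.1 hw
    have hws : coordSum w = 3 / 4 :=
      (convex_coordSum_preimage (convex_singleton (3 / 4))).segment_subset
        (by rw [Set.mem_ofPred_eq, coordSum_vec]; norm_num) (by norm_num [coordSum, quarterPoint]) hw
    refine ⟨hwc, ?_⟩
    by_cases h : w = quarterPoint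
    · rw [h, polyQVec_quarterPoint]
    · exact (polyQVec_pos_of_coordSum_eq hwc hws h).le
  · obtain ⟨b, hb, hbs, hbne, hseg⟩ := exists_joinedIn_chord ha.1 ha.2 hne
    refine ((joinedIn_polyQPosPart_of_coordSum_eq hb hbs hbne).mono hsub).trans
      (JoinedIn.of_segment_subset ?_).symm
    intro w hw
    obtain ⟨h1, rfl | h2⟩ := hseg w hw
    exacts [ha, ⟨h1, h2.le⟩]

/-! ### The zero set as a continuous image of `{Q ≥ 0}` -/

theorem exists_towardDiag_zero {a : Fin 3 → ℝ} (ha : a ∈ polyQNonnegPart) :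
    ∃ r ∈ Set.Icc (0 : ℝ) 1, polyQVec (towardDiag a r) = 0 := by
  have hc : ContinuousOn (fun r => polyQVec (towardDiag a r)) (Set.Icc 0 1) :=
    (continuous_polyQVec.comp (continuous_towardDiag.comp
      (Continuous.prodMk_right a))).continuousOn
  refine intermediate_value_Icc zero_le_one hc ⟨?_, ?_⟩
  · rw [towardDiag_zero, polyQVec_diagProj, neg_nonpos]
    positivity
  · rw [towardDiag_one]; exact ha.2

/-- Off the slice, a zero forces `Q < 0` strictly inside its segment; on it, the only zero is
`quarterPoint`. The point is unique but not the parameter, since the segment of `quarterPoint` is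
constant. -/
theorem towardDiag_zero_unique {a : Fin 3 → ℝ} (ha : a ∈ openCube) {r s : ℝ}
    (hr : r ∈ Set.Icc (0 : ℝ) 1) (hs : s ∈ Set.Icc (0 : ℝ) 1)
    (hr0 : polyQVec (towardDiag a r) = 0) (hs0 : polyQVec (towardDiag a s) = 0) :
    towardDiag a r = towardDiag a s := by
  by_cases h34 : coordSum a = 3 / 4
  · have key : ∀ t ∈ Set.Icc (0 : ℝ) 1, polyQVec (towardDiag a t) = 0 →
        towardDiag a t = quarterPoint := by
      intro t ht h0
      by_contra hne
      have := polyQVec_pos_of_coordSum_eq (towardDiag_mem ha ht)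
        (by rw [coordSum_towardDiag, h34]) hne
      linarith
    rw [key r hr hr0, key s hs hs0]
  · have key : ∀ {r s : ℝ}, r ∈ Set.Icc (0 : ℝ) 1 → s ∈ Set.Icc (0 : ℝ) 1 →
        polyQVec (towardDiag a r) = 0 → polyQVec (towardDiag a s) = 0 → ¬ r < s := by
      intro r s hr hs hr0 hs0 hlt
      have hs' : 0 < s := hr.1.trans_lt hlt
      have := polyQVec_towardDiag_neg (towardDiag_mem ha hs) hs0.le
        (by rwa [coordSum_towardDiag]) (div_nonneg hr.1 hs'.le) ((div_lt_one hs').2 hlt)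
      rw [towardDiag_towardDiag, div_mul_cancel₀ _ hs'.ne', hr0] at this
      exact lt_irrefl _ this
    rw [le_antisymm (not_lt.1 (key hs hr hs0 hr0)) (not_lt.1 (key hr hs hr0 hs0))]

theorem isPreconnected_openCube_inter_surfaceOmega :
    IsPreconnected (openCube ∩ surfaceOmega) := by
  choose ρ hρ hρ0 using fun a : polyQNonnegPart => exists_towardDiag_zero a.2
  let f : polyQNonnegPart → Fin 3 → ℝ := fun a => towardDiag a (ρ a)
  have hf : Continuous f := by
    rw [continuous_iff_isClosed]
    intro K hK
    -- Uniqueness makes the choice of `ρ` irrelevant, so preimages of closed sets are projections of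
    -- closed sets along the compact `[0, 1]`, hence closed. No continuity of `ρ` is needed.
    have hpre : f ⁻¹' K = Prod.fst '' {p : polyQNonnegPart × Set.Icc (0 : ℝ) 1 |
        polyQVec (towardDiag p.1 p.2) = 0 ∧ towardDiag p.1 p.2 ∈ K} := by
      ext a
      constructor
      · intro h
        exact ⟨(a, ⟨ρ a, hρ a⟩), ⟨hρ0 a, h⟩, rfl⟩
      · rintro ⟨⟨b, r⟩, ⟨h0, hK'⟩, rfl⟩
        have := towardDiag_zero_unique b.2.1 (hρ b) r.2 (hρ0 b) h0
        simpa only [Set.mem_preimage, f, this] using hK'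
    rw [hpre]
    apply isClosedMap_fst_of_compactSpace
    have hc : Continuous fun p : polyQNonnegPart × Set.Icc (0 : ℝ) 1 =>
        towardDiag (p.1 : Fin 3 → ℝ) (p.2 : ℝ) :=
      continuous_towardDiag.comp
        ((continuous_subtype_val.comp continuous_fst).prodMk
          (continuous_subtype_val.comp continuous_snd))
    exact (isClosed_eq (continuous_polyQVec.comp hc) continuous_const).inter (hK.preimage hc)
  have : PreconnectedSpace polyQNonnegPart :=
    isPreconnected_iff_preconnectedSpace.1 isPreconnected_polyQNonnegPart
  have hrange : Set.range f = openCube ∩ surfaceOmega := by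
    ext b
    constructor
    · rintro ⟨a, rfl⟩
      exact ⟨towardDiag_mem a.2.1 (hρ a), hρ0 a⟩
    · rintro ⟨hb, hb0⟩
      have hb0' : polyQVec b = 0 := hb0
      -- A zero is its own image: parameter `1` is admissible and the zero on the segment is unique.
      refine ⟨⟨b, hb, hb0'.ge⟩, ?_⟩
      have := towardDiag_zero_unique hb (hρ ⟨b, hb, hb0'.ge⟩) (s := 1) ⟨zero_le_one, le_rfl⟩
        (hρ0 ⟨b, hb, hb0'.ge⟩) (by rwa [towardDiag_one])
      rwa [towardDiag_one] at this
  rw [← hrange]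
  exact isPreconnected_range hf

/-! ### Components of a disjoint union of open preconnected sets -/

theorem connectedComponentIn_eq_of_isOpen {X : Type*} [TopologicalSpace X] {S U V : Set X}
    (hS : S = U ∪ V) (hU : IsOpen U) (hV : IsOpen V) (hUV : Disjoint U V)
    (hUc : IsPreconnected U) {x : X} (hx : x ∈ U) : connectedComponentIn S x = U := by
  have hxS : x ∈ S := hS ▸ Or.inl hx
  apply Set.Subset.antisymm
  · exact isPreconnected_connectedComponentIn.subset_left_of_subset_union hU hV hUV
      (hS ▸ connectedComponentIn_subset S x) ⟨x, mem_connectedComponentIn hxS, hx⟩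
  · exact hUc.subset_connectedComponentIn hx (hS ▸ Set.subset_union_left)

theorem componentsOf_eq_triple {X : Type*} [TopologicalSpace X] {S U V W : Set X}
    (hS : S = U ∪ V ∪ W) (hU : IsOpen U) (hV : IsOpen V) (hW : IsOpen W) (hUV : Disjoint U V)
    (hUW : Disjoint U W) (hVW : Disjoint V W) (hUc : IsPreconnected U) (hVc : IsPreconnected V)
    (hWc : IsPreconnected W) (hUn : U.Nonempty) (hVn : V.Nonempty) (hWn : W.Nonempty) :
    componentsOf S = {U, V, W} := by
  have eU : ∀ x ∈ U, connectedComponentIn S x = U := fun x hx =>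
    connectedComponentIn_eq_of_isOpen (V := V ∪ W) (by rw [hS, Set.union_assoc]) hU
      (hV.union hW) (Set.disjoint_union_right.2 ⟨hUV, hUW⟩) hUc hx
  have eV : ∀ x ∈ V, connectedComponentIn S x = V := fun x hx =>
    connectedComponentIn_eq_of_isOpen (V := U ∪ W)
      (by rw [hS, Set.union_comm U V, Set.union_assoc]) hV
      (hU.union hW) (Set.disjoint_union_right.2 ⟨hUV.symm, hVW⟩) hVc hx
  have eW : ∀ x ∈ W, connectedComponentIn S x = W := fun x hx =>
    connectedComponentIn_eq_of_isOpen (V := U ∪ V) (by rw [hS, Set.union_comm]) hW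
      (hU.union hV) (Set.disjoint_union_right.2 ⟨hUW.symm, hVW.symm⟩) hWc hx
  ext C
  constructor
  · rintro ⟨x, hx, rfl⟩
    rw [hS] at hx
    rcases hx with (hx | hx) | hx
    · simp [eU x hx]
    · simp [eV x hx]
    · simp [eW x hx]
  · rintro (rfl | rfl | rfl)
    · obtain ⟨x, hx⟩ := hUn
      exact ⟨x, hS ▸ Or.inl (Or.inl hx), (eU x hx).symm⟩
    · obtain ⟨x, hx⟩ := hVn
      exact ⟨x, hS ▸ Or.inl (Or.inr hx), (eV x hx).symm⟩
    · obtain ⟨x, hx⟩ := hWn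
      exact ⟨x, hS ▸ Or.inr hx, (eW x hx).symm⟩

end Topology

theorem theorem1 :
    IsConnected (openCube ∩ surfaceOmega) ∧
    (componentsOf (openCube \ surfaceOmega)).ncard = 3 ∧
    ∃ O₁ O₂ O₃ : Set (Fin 3 → ℝ),
      componentsOf (openCube \ surfaceOmega) = {O₁, O₂, O₃} ∧
      ![1 / 6, 1 / 6, 1 / 6] ∈ O₁ ∧
      ![7 / 15, 7 / 15, 7 / 15] ∈ O₂ ∧
      ![1 / 6, 1 / 4, 1 / 3] ∈ O₃ := by
  have m₁ : (![1 / 6, 1 / 6, 1 / 6] : Fin 3 → ℝ) ∈ polyQNegPart (Set.Iio (3 / 4)) :=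
    ⟨fun i => by fin_cases i <;> norm_num, by rw [polyQVec_vec]; norm_num [polyQ], by rw [coordSum_vec]; norm_num⟩
  have m₂ : (![7 / 15, 7 / 15, 7 / 15] : Fin 3 → ℝ) ∈ polyQNegPart (Set.Ioi (3 / 4)) :=
    ⟨fun i => by fin_cases i <;> norm_num, by rw [polyQVec_vec]; norm_num [polyQ], by rw [coordSum_vec]; norm_num⟩
  have m₃ : (![1 / 6, 1 / 4, 1 / 3] : Fin 3 → ℝ) ∈ polyQPosPart :=
    ⟨fun i => by fin_cases i <;> norm_num, by rw [polyQVec_vec]; norm_num [polyQ]⟩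
  have hcover : openCube \ surfaceOmega =
      polyQNegPart (Set.Iio (3 / 4)) ∪ polyQNegPart (Set.Ioi (3 / 4)) ∪ polyQPosPart := by
    ext a
    constructor
    · rintro ⟨ha, hne⟩
      rcases lt_or_gt_of_ne (show polyQVec a ≠ 0 from hne) with h | h
      · rcases lt_trichotomy (coordSum a) (3 / 4) with hs | hs | hs
        · exact Or.inl (Or.inl ⟨ha, h, hs⟩)
        · exfalso
          by_cases hq : a = quarterPoint
          · rw [hq, polyQVec_quarterPoint] at h
            exact lt_irrefl _ h
          · exact lt_asymm h (polyQVec_pos_of_coordSum_eq ha hs hq)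
        · exact Or.inl (Or.inr ⟨ha, h, hs⟩)
      · exact Or.inr ⟨ha, h⟩
    · rintro ((⟨ha, h, -⟩ | ⟨ha, h, -⟩) | ⟨ha, h⟩)
      exacts [⟨ha, h.ne⟩, ⟨ha, h.ne⟩, ⟨ha, h.ne'⟩]
  have d₁₂ : Disjoint (polyQNegPart (Set.Iio (3 / 4))) (polyQNegPart (Set.Ioi (3 / 4))) :=
    Set.disjoint_left.2 fun a h h' => lt_asymm (Set.mem_Iio.1 h.2.2) (Set.mem_Ioi.1 h'.2.2)
  have d₁₃ : Disjoint (polyQNegPart (Set.Iio (3 / 4))) polyQPosPart :=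
    Set.disjoint_left.2 fun a h h' => lt_asymm h.2.1 h'.2
  have d₂₃ : Disjoint (polyQNegPart (Set.Ioi (3 / 4))) polyQPosPart :=
    Set.disjoint_left.2 fun a h h' => lt_asymm h.2.1 h'.2
  have hcomp := componentsOf_eq_triple hcover (isOpen_polyQNegPart isOpen_Iio)
    (isOpen_polyQNegPart isOpen_Ioi) isOpen_polyQPosPart d₁₂ d₁₃ d₂₃
    (isPreconnected_polyQNegPart (convex_Iio _) (by simp))
    (isPreconnected_polyQNegPart (convex_Ioi _) (by simp)) isPreconnected_polyQPosPart
    ⟨_, m₁⟩ ⟨_, m₂⟩ ⟨_, m₃⟩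
  refine ⟨⟨⟨quarterPoint, quarterPoint_mem, polyQVec_quarterPoint⟩,
    isPreconnected_openCube_inter_surfaceOmega⟩, ?_, _, _, _, hcomp, m₁, m₂, m₃⟩
  rw [hcomp]
  exact Set.ncard_eq_three.2 ⟨_, _, _, d₁₂.ne (Set.nonempty_iff_ne_empty.1 ⟨_, m₁⟩),
    d₁₃.ne (Set.nonempty_iff_ne_empty.1 ⟨_, m₁⟩),
    d₂₃.ne (Set.nonempty_iff_ne_empty.1 ⟨_, m₂⟩), rfl⟩
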